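/- **Corollary 5.** A regular germ $f_a$ at a point $a$ of the Riemann sphere $\mathbb S^2=\mathbb C\cup\{\infty\}$ is the germ at $a$ of a holomorphic function with values in $\mathbb C$. Two regular germs are equivalent if one is obtained from the other by analytic continuation along a path in $\mathbb S^2$; the multivalued analytic function $f$ generated by $f_a$ is the collection of all regular germs equivalent to $f_a$, which are called its germs. A point $b\in\mathbb S^2$ is a singular point of $f$ if for some germ $f_a$ of $f$ there is a path $\gamma:[0,1]\to\mathbb S^2$ from $a$ to $b$ such that $f_a$ has no analytic continuation along $\gamma$, but has one along $\gamma|_{[0,\tau]}$ for every $0\le\tau<1$. An operation on multivalued functions is performed on arbitrary regular germs of the given functions at a common point, and its results are all multivalued functions generated by the regular germs so obtained. (For a composition $f\circ g$ one takes a germ of $g$ at $a$ and a germ of $f$ at $g(a)$; for a quotient $f/g$ the germ of $g$ is not identically zero.) The class given by a list of basic functions and a list of operations consists of all functions obtained from the basic ones by repeated application of the operations. The basic elementary functions are: the complex constants, the independent variable $x$, $\exp$, $\log$, $x^\alpha$ $(\alpha\in\mathbb C)$, $\sin,\cos,\tan,\cot,\arcsin,\arccos,\arctan,\operatorname{arccot}$.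 With these as basic functions, one defines * functions representable by quadratures, by the operations of composition, the arithmetic operations $f+g$, $f-g$, $fg$, $f/g$, differentiation, and integration (passing from $f$ to a solution of $y'=f$); * functions representable by $k$-quadratures, by the same operations and the solution of algebraic equations $y^n+f_1y^{n-1}+\dots+f_n=0$ of degree $n\le k$; * functions representable by generalized quadratures, by the same operations as for quadratures and the solution of algebraic equations of any degree; * generalized elementary functions, by composition, arithmetic operations, differentiation, and the solution of algebraic equations of any degree. Let $f$ be a multivalued analytic function whose set of singular points is uncountable. Then $f$ is not representable by generalized quadratures. In particular, $f$ is not a generalized elementary function, and $f$ is representable neither by $k$-quadratures, for any $k\in\mathbb N$, nor by quadratures. -/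

import Mathlib

namespace FiniteTerms

open scoped Topology unitInterval

/-- The Riemann sphere. -/
abbrev Sphere : Type := OnePoint ℂ

/-- The chart of the sphere at infinity, `w ↦ 1 / w`, with `0 ↦ ∞`. -/
noncomputable def chartInfty (w : ℂ) : Sphere :=
  open Classical in if w = 0 then OnePoint.infty else ((w⁻¹ : ℂ) : Sphere)

/-- `φ` is holomorphic (with finite values) in a neighbourhood of the point `a` of the sphere. A
regular germ at `a` is given by any `φ` with `RegularAt φ a`; two such functions give the same germ
when they agree near `a`. -/
def RegularAt (φ : Sphere → ℂ) (a : Sphere) : Prop :=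
  (∀ z : ℂ, a = (z : Sphere) → AnalyticAt ℂ (fun w : ℂ => φ (w : Sphere)) z) ∧
  (a = OnePoint.infty → AnalyticAt ℂ (fun w : ℂ => φ (chartInfty w)) 0)

/-- `F` is an analytic continuation of the germ of `φ` at `a` along the part `[0, τ]` of the path
`γ`: `F t` is a regular germ at `γ t`, the germs at nearby times being induced by the same
function. -/
def IsContinuation {a b : Sphere} (γ : Path a b) (τ : I) (φ : Sphere → ℂ)
    (F : I → Sphere → ℂ) : Prop :=
  F 0 =ᶠ[𝓝 a] φ ∧
  ∀ t : I, t ≤ τ → RegularAt (F t) (γ t) ∧ ∀ᶠ s in 𝓝 t, s ≤ τ → F s =ᶠ[𝓝 (γ s)] F t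

/-- The germ of `ψ` at `b` is obtained from the germ of `φ` at `a` by analytic continuation along
some path. -/
def Equivalent (a : Sphere) (φ : Sphere → ℂ) (b : Sphere) (ψ : Sphere → ℂ) : Prop :=
  ∃ (γ : Path a b) (F : I → Sphere → ℂ), IsContinuation γ 1 φ F ∧ F 1 =ᶠ[𝓝 b] ψ

/-- `b` is a singular point for the germ of `φ` at `a`. -/
def IsSingularPoint (a : Sphere) (φ : Sphere → ℂ) (b : Sphere) : Prop :=
  ∃ γ : Path a b, (¬ ∃ F, IsContinuation γ 1 φ F) ∧ ∀ τ : I, τ < 1 → ∃ F, IsContinuation γ τ φ F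

/-- A multivalued analytic function on the sphere: the collection of all regular germs equivalent
to one given regular germ. `IsGerm a φ` says that `φ` represents one of its germs at `a`. -/
structure MultivaluedFunction where
  IsGerm : Sphere → (Sphere → ℂ) → Prop
  generated : ∃ a φ, RegularAt φ a ∧ ∀ b ψ, IsGerm b ψ ↔ Equivalent a φ b ψ

/-- `f` is the multivalued function generated by the regular germ of `φ` at `a`. -/
def MultivaluedFunction.IsGeneratedBy (f : MultivaluedFunction) (a : Sphere)
    (φ : Sphere → ℂ) : Prop :=
  RegularAt φ a ∧ ∀ b ψ, f.IsGerm b ψ ↔ Equivalent a φ b ψ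

/-- The set of singular points of a multivalued function. -/
def MultivaluedFunction.singularPoints (f : MultivaluedFunction) : Set Sphere :=
  {b | ∃ a φ, f.IsGerm a φ ∧ IsSingularPoint a φ b}

/-- `f` is generated by a germ of the (single valued) function `u`. -/
def IsFunction (u : ℂ → ℂ) (f : MultivaluedFunction) : Prop :=
  ∃ a φ, f.IsGeneratedBy a φ ∧ ∀ᶠ x in 𝓝 a, ∀ z : ℂ, x = (z : Sphere) → φ x = u z

/-- `f` is generated by a germ `φ` inverse to `u`, that is `u (φ z) = z`. -/
def IsInverseFunction (u : ℂ → ℂ) (f : MultivaluedFunction) : Prop :=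
  ∃ a φ, f.IsGeneratedBy a φ ∧ ∀ᶠ x in 𝓝 a, ∀ z : ℂ, x = (z : Sphere) → u (φ x) = z

/-- `f` is the power `x ^ α`: it is generated by a germ `exp (α ℓ)`, where `ℓ` is a germ of the
logarithm. -/
def IsPower (α : ℂ) (f : MultivaluedFunction) : Prop :=
  ∃ a l, RegularAt l a ∧
    (∀ᶠ x in 𝓝 a, ∀ z : ℂ, x = (z : Sphere) → Complex.exp (l x) = z) ∧
    f.IsGeneratedBy a (fun x => Complex.exp (α * l x))

/-- The basic elementary functions. -/
inductive BasicElementary : MultivaluedFunction → Prop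
  | const (c : ℂ) {f} : IsFunction (fun _ => c) f → BasicElementary f
  | var {f} : IsFunction (fun z => z) f → BasicElementary f
  | exp {f} : IsFunction Complex.exp f → BasicElementary f
  | log {f} : IsInverseFunction Complex.exp f → BasicElementary f
  | power (α : ℂ) {f} : IsPower α f → BasicElementary f
  | sin {f} : IsFunction Complex.sin f → BasicElementary f
  | cos {f} : IsFunction Complex.cos f → BasicElementary f
  | tan {f} : IsFunction Complex.tan f → BasicElementary f
  | cot {f} : IsFunction Complex.cot f → BasicElementary f
  | arcsin {f} : IsInverseFunction Complex.sin f → BasicElementary f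
  | arccos {f} : IsInverseFunction Complex.cos f → BasicElementary f
  | arctan {f} : IsInverseFunction Complex.tan f → BasicElementary f
  | arccot {f} : IsInverseFunction Complex.cot f → BasicElementary f

/-- An operation on multivalued functions: `Op fs h` says that `h` is one of the functions obtained
from the list of functions `fs` by the operation. -/
abbrev Operation : Type := List MultivaluedFunction → MultivaluedFunction → Prop

/-- `h` is representable as `f ∘ g`. -/
inductive Composition : Operation
  | comp {f g h : MultivaluedFunction} {a : Sphere} {φ ψ : Sphere → ℂ} :
      g.IsGerm a ψ → f.IsGerm ((ψ a : ℂ) : Sphere) φ →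
      h.IsGeneratedBy a (fun x => φ ((ψ x : ℂ) : Sphere)) → Composition [f, g] h

/-- `h` is representable as `f + g`, `f - g`, `f g` or `f / g`. In the last case the germ of `g` is
not identically zero. -/
inductive Arithmetic : Operation
  | add {f g h : MultivaluedFunction} {a : Sphere} {φ ψ : Sphere → ℂ} :
      f.IsGerm a φ → g.IsGerm a ψ → h.IsGeneratedBy a (fun x => φ x + ψ x) → Arithmetic [f, g] h
  | sub {f g h : MultivaluedFunction} {a : Sphere} {φ ψ : Sphere → ℂ} :
      f.IsGerm a φ → g.IsGerm a ψ → h.IsGeneratedBy a (fun x => φ x - ψ x) → Arithmetic [f, g] h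
  | mul {f g h : MultivaluedFunction} {a : Sphere} {φ ψ : Sphere → ℂ} :
      f.IsGerm a φ → g.IsGerm a ψ → h.IsGeneratedBy a (fun x => φ x * ψ x) → Arithmetic [f, g] h
  | div {f g h : MultivaluedFunction} {a : Sphere} {φ ψ χ : Sphere → ℂ} :
      f.IsGerm a φ → g.IsGerm a ψ → (¬ ∀ᶠ x in 𝓝 a, ψ x = 0) → h.IsGeneratedBy a χ →
      (∀ᶠ x in 𝓝 a, χ x * ψ x = φ x) → Arithmetic [f, g] h

/-- Near `a` (at finite points), `χ` is the derivative of `φ` with respect to the independent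
variable. -/
def IsDerivativeNear (a : Sphere) (φ χ : Sphere → ℂ) : Prop :=
  ∀ᶠ x in 𝓝 a, ∀ z : ℂ, x = (z : Sphere) → HasDerivAt (fun w : ℂ => φ (w : Sphere)) (χ x) z

/-- `h` is representable as `f'`. -/
inductive Differentiation : Operation
  | deriv {f h : MultivaluedFunction} {a : Sphere} {φ χ : Sphere → ℂ} :
      f.IsGerm a φ → h.IsGeneratedBy a χ → IsDerivativeNear a φ χ → Differentiation [f] h

/-- `h` is representable as a solution `y` of `y' = f`. -/
inductive Integration : Operation
  | integral {f h : MultivaluedFunction} {a : Sphere} {φ χ : Sphere → ℂ} :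
      f.IsGerm a φ → h.IsGeneratedBy a χ → IsDerivativeNear a χ φ → Integration [f] h

/-- `h` is representable as a solution `y` of an algebraic equation
`y ^ n + f₁ y ^ (n - 1) + ⋯ + fₙ = 0` whose degree `n` satisfies `D n`; the
coefficients `f₁, …, fₙ` are `f i` for `i = 0, …, n - 1`. -/
inductive Algebraic (D : ℕ → Prop) : Operation
  | solution {n : ℕ} {f : Fin n → MultivaluedFunction} {h : MultivaluedFunction} {a : Sphere}
      {φ : Fin n → Sphere → ℂ} {χ : Sphere → ℂ} :
      D n → (∀ i, (f i).IsGerm a (φ i)) → h.IsGeneratedBy a χ →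
      (∀ᶠ x in 𝓝 a, χ x ^ n + ∑ i : Fin n, φ i x * χ x ^ (n - 1 - (i : ℕ)) = 0) →
      Algebraic D (List.ofFn f) h

/-- The class of functions given by a list of basic functions and a list of admissible operations:
all functions obtained from the basic ones by repeated application of the operations. -/
inductive FunctionClass (Basic : MultivaluedFunction → Prop) (Op : Operation) :
    MultivaluedFunction → Prop
  | basic {f} : Basic f → FunctionClass Basic Op f
  | op {fs h} : (∀ f ∈ fs, FunctionClass Basic Op f) → Op fs h → FunctionClass Basic Op h

/-- Generalized elementary functions. -/
def GeneralizedElementary : MultivaluedFunction → Prop :=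
  FunctionClass BasicElementary
    (Composition ⊔ Arithmetic ⊔ Differentiation ⊔ Algebraic (fun _ => True))

/-- Functions representable by quadratures. -/
def RepresentableByQuadratures : MultivaluedFunction → Prop :=
  FunctionClass BasicElementary (Composition ⊔ Arithmetic ⊔ Differentiation ⊔ Integration)

/-- Functions representable by `k`-quadratures. -/
def RepresentableByKQuadratures (k : ℕ) : MultivaluedFunction → Prop :=
  FunctionClass BasicElementary
    (Composition ⊔ Arithmetic ⊔ Differentiation ⊔ Integration ⊔ Algebraic (fun n => n ≤ k))

/-- Functions representable by generalized quadratures. -/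
def RepresentableByGeneralizedQuadratures : MultivaluedFunction → Prop :=
  FunctionClass BasicElementary
    (Composition ⊔ Arithmetic ⊔ Differentiation ⊔ Integration ⊔ Algebraic (fun _ => True))

end FiniteTerms

/-!
Call a set `A` forbidden for a germ if the germ continues along every path that avoids `A` after its
start. A path can be perturbed off a countable set without disturbing a given continuation, so
having a given countable forbidden set passes from a germ to the germs equivalent to it, and a
singular point of a function lies in every countable set that is forbidden for its germs. It is
therefore enough that the basic functions have countable forbidden sets and that the operations
preserve this property.

For each operation the forbidden sets of the operands are enlarged by a countable set: the point at
infinity for differentiation and integration; for quotients the points where a germ of the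
denominator vanishes, and for compositions those where a germ of `g` takes a value forbidden for
`f`. By the Poincaré–Volterra theorem, countably many functions represent all the germs reached from
a given one, so a nonconstant germ takes a given value at only countably many points. For an
algebraic equation, a polynomial of minimal degree for the solution over the germs with a given
forbidden set is separable off the zeros of one such germ, and there its simple roots continue
analytically.
-/

namespace FiniteTerms

open scoped unitInterval
open Filter Set Topology

variable {A : Set Sphere} {a b : Sphere} {φ ψ χ : Sphere → ℂ} {c : ℂ → Sphere}

/-- A holomorphic chart of the sphere, parametrized by the whole plane. -/
structure IsChart (c : ℂ → Sphere) : Prop where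
  isOpenEmbedding : IsOpenEmbedding c
  regularAt_iff : ∀ (φ : Sphere → ℂ) (z : ℂ), RegularAt φ (c z) ↔ AnalyticAt ℂ (fun w => φ (c w)) z

/-- The inversion `x ↦ 1 / x` of the sphere, which carries the finite chart to `chartInfty`. -/
noncomputable def sphereInv (x : Sphere) : Sphere :=
  OnePoint.elim x ((0 : ℂ) : Sphere) chartInfty

section Charts

theorem regularAt_coe {z : ℂ} :
    RegularAt φ (z : Sphere) ↔ AnalyticAt ℂ (fun w : ℂ => φ (w : Sphere)) z := by
  refine ⟨fun h => h.1 z rfl, fun h => ⟨fun z' hz => ?_, fun h' => ?_⟩⟩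
  · rwa [← OnePoint.coe_injective hz]
  · exact absurd h' (OnePoint.coe_ne_infty z)

theorem regularAt_infty :
    RegularAt φ OnePoint.infty ↔ AnalyticAt ℂ (fun w : ℂ => φ (chartInfty w)) 0 :=
  ⟨fun h => h.2 rfl, fun h => ⟨fun z hz => absurd hz.symm (OnePoint.coe_ne_infty z), fun _ => h⟩⟩

theorem isChart_coe : IsChart (fun z : ℂ => (z : Sphere)) :=
  ⟨OnePoint.isOpenEmbedding_coe, fun _ _ => regularAt_coe⟩

theorem chartInfty_zero : chartInfty 0 = OnePoint.infty := by simp [chartInfty]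

theorem chartInfty_of_ne_zero {w : ℂ} (hw : w ≠ 0) : chartInfty w = ((w⁻¹ : ℂ) : Sphere) := by
  simp [chartInfty, hw]

theorem chartInfty_eventuallyEq {z : ℂ} (hz : z ≠ 0) :
    chartInfty =ᶠ[𝓝 z] fun w => ((w⁻¹ : ℂ) : Sphere) := by
  filter_upwards [isOpen_ne.mem_nhds hz] with w hw using chartInfty_of_ne_zero hw

theorem sphereInv_coe (z : ℂ) : sphereInv (z : Sphere) = chartInfty z := rfl

theorem sphereInv_infty : sphereInv OnePoint.infty = ((0 : ℂ) : Sphere) := rfl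

theorem involutive_sphereInv : Function.Involutive sphereInv := by
  intro x
  induction x using OnePoint.rec with
  | infty => rw [sphereInv_infty, sphereInv_coe, chartInfty_zero]
  | coe z =>
    rw [sphereInv_coe]
    by_cases hz : z = 0
    · rw [hz, chartInfty_zero, sphereInv_infty]
    · rw [chartInfty_of_ne_zero hz, sphereInv_coe, chartInfty_of_ne_zero (inv_ne_zero hz), inv_inv]

theorem coclosedCompact_complex : coclosedCompact ℂ = Bornology.cobounded ℂ := by
  rw [coclosedCompact_eq_cocompact, Metric.cobounded_eq_cocompact]

theorem continuous_chartInfty : Continuous chartInfty := by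
  refine continuous_iff_continuousAt.2 fun z => ?_
  by_cases hz : z = 0
  · have hinv : Tendsto (fun w : ℂ => ((w⁻¹ : ℂ) : Sphere)) (𝓝[≠] 0) (𝓝 OnePoint.infty) :=
      OnePoint.tendsto_coe_infty.comp (coclosedCompact_complex ▸ tendsto_inv₀_nhdsNE_zero)
    rw [hz, continuousAt_iff_punctured_nhds, chartInfty_zero]
    refine hinv.congr' ?_
    filter_upwards [self_mem_nhdsWithin] with w hw using (chartInfty_of_ne_zero hw).symm
  · exact (OnePoint.continuous_coe.continuousAt.comp (continuousAt_inv₀ hz)).congr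
      (chartInfty_eventuallyEq hz).symm

theorem continuous_sphereInv : Continuous sphereInv := by
  refine (OnePoint.continuous_iff _).2 ⟨?_, continuous_chartInfty⟩
  have hinv : Tendsto (fun w : ℂ => ((w⁻¹ : ℂ) : Sphere)) (Bornology.cobounded ℂ)
      (𝓝 ((0 : ℂ) : Sphere)) :=
    OnePoint.continuous_coe.continuousAt.tendsto.comp tendsto_inv₀_cobounded
  rw [coclosedCompact_complex, sphereInv_infty]
  refine hinv.congr' ?_
  filter_upwards [Bornology.eventually_ne_cobounded (0 : ℂ)] with w hw
  rw [sphereInv_coe, chartInfty_of_ne_zero hw]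

theorem isOpenEmbedding_chartInfty : IsOpenEmbedding chartInfty :=
  let e : Sphere ≃ₜ Sphere :=
    { involutive_sphereInv.toPerm with
      continuous_toFun := continuous_sphereInv
      continuous_invFun := continuous_sphereInv }
  e.isOpenEmbedding.comp OnePoint.isOpenEmbedding_coe

theorem analyticAt_comp_inv_iff {g : ℂ → ℂ} {z : ℂ} (hz : z ≠ 0) :
    AnalyticAt ℂ (fun w => g w⁻¹) z ↔ AnalyticAt ℂ g z⁻¹ := by
  have comp_inv : ∀ {f : ℂ → ℂ} {x : ℂ}, x ≠ 0 → AnalyticAt ℂ f x⁻¹ →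
      AnalyticAt ℂ (fun w => f w⁻¹) x :=
    fun hx hf => AnalyticAt.comp_of_eq hf (analyticAt_inv hx) rfl
  refine ⟨fun h => ?_, comp_inv hz⟩
  simpa only [inv_inv] using comp_inv (f := fun w => g w⁻¹) (inv_ne_zero hz) (by rwa [inv_inv])

theorem isChart_chartInfty : IsChart chartInfty := by
  refine ⟨isOpenEmbedding_chartInfty, fun φ z => ?_⟩
  by_cases hz : z = 0
  · rw [hz, chartInfty_zero, regularAt_infty]
  · rw [chartInfty_of_ne_zero hz, regularAt_coe, ← analyticAt_comp_inv_iff hz]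
    exact analyticAt_congr ((chartInfty_eventuallyEq hz).symm.fun_comp φ)

theorem mem_range_coe_or_mem_range_chartInfty (a : Sphere) :
    a ∈ range (fun z : ℂ => (z : Sphere)) ∨ a ∈ range chartInfty := by
  induction a using OnePoint.rec with
  | infty => exact Or.inr ⟨0, chartInfty_zero⟩
  | coe z => exact Or.inl ⟨z, rfl⟩

theorem exists_isChart (a : Sphere) : ∃ c, IsChart c ∧ ∃ z, c z = a :=
  (mem_range_coe_or_mem_range_chartInfty a).elim (fun h => ⟨_, isChart_coe, h⟩)
    fun h => ⟨_, isChart_chartInfty, h⟩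

namespace IsChart

theorem eventually_iff (hc : IsChart c) {z : ℂ} {p : Sphere → Prop} :
    (∀ᶠ x in 𝓝 (c z), p x) ↔ ∀ᶠ w in 𝓝 z, p (c w) := by
  rw [← hc.isOpenEmbedding.map_nhds_eq, eventually_map]

theorem eventually_nhdsNE_iff (hc : IsChart c) {z : ℂ} {p : Sphere → Prop} :
    (∀ᶠ x in 𝓝[≠] (c z), p x) ↔ ∀ᶠ w in 𝓝[≠] z, p (c w) := by
  have hz : c ⁻¹' {c z}ᶜ = {z}ᶜ := by
    rw [preimage_compl, ← image_singleton, preimage_image_eq _ hc.isOpenEmbedding.injective]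
  rw [← hz, ← hc.isOpenEmbedding.map_nhdsWithin_preimage_eq, eventually_map]

theorem secondCountableTopology_range (hc : IsChart c) : SecondCountableTopology (range c) :=
  hc.isOpenEmbedding.isEmbedding.toHomeomorph.symm.secondCountableTopology

end IsChart

instance : SecondCountableTopology Sphere := by
  let U : Bool → Set Sphere := fun i => cond i (range chartInfty) (range fun z : ℂ => (z : Sphere))
  have (i : Bool) : SecondCountableTopology (U i) := by
    cases i
    exacts [isChart_coe.secondCountableTopology_range,
      isChart_chartInfty.secondCountableTopology_range]
  refine TopologicalSpace.secondCountableTopology_of_countable_cover (U := U) (fun i => ?_)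
    (eq_univ_of_forall fun x => mem_iUnion.2 ?_)
  · cases i
    exacts [isChart_coe.isOpenEmbedding.isOpen_range,
      isChart_chartInfty.isOpenEmbedding.isOpen_range]
  · exact (mem_range_coe_or_mem_range_chartInfty x).elim (⟨false, ·⟩) (⟨true, ·⟩)

noncomputable instance : MetricSpace Sphere := TopologicalSpace.metrizableSpaceMetric Sphere

end Charts

theorem iff_of_isPreconnected {α : Type*} [TopologicalSpace α] {T : Set α} (hT : IsPreconnected T)
    {Q : α → Prop} (h : ∀ t ∈ T, ∀ᶠ s in 𝓝[T] t, (Q t ↔ Q s)) {t₀ t : α} (h₀ : t₀ ∈ T)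
    (ht : t ∈ T) : Q t₀ ↔ Q t :=
  hT.induction₂ (fun x y => (Q x ↔ Q y)) h (fun _ _ _ _ _ _ h₁ h₂ => h₁.trans h₂)
    (fun _ _ _ _ h₁ => h₁.symm) h₀ ht

section RegularGerms

theorem regularAt_const (k : ℂ) (a : Sphere) : RegularAt (fun _ => k) a := by
  obtain ⟨c, hc, z, rfl⟩ := exists_isChart a
  exact (hc.regularAt_iff _ _).2 analyticAt_const

namespace RegularAt

theorem congr (h : RegularAt φ a) (e : φ =ᶠ[𝓝 a] ψ) : RegularAt ψ a := by
  obtain ⟨c, hc, z, rfl⟩ := exists_isChart a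
  rw [hc.regularAt_iff] at h ⊢
  exact h.congr (hc.eventually_iff.1 e)

theorem eventually (h : RegularAt φ a) : ∀ᶠ x in 𝓝 a, RegularAt φ x := by
  obtain ⟨c, hc, z, rfl⟩ := exists_isChart a
  simp only [hc.eventually_iff, hc.regularAt_iff] at h ⊢
  exact h.eventually_analyticAt

theorem continuousAt (h : RegularAt φ a) : ContinuousAt φ a := by
  obtain ⟨c, hc, z, rfl⟩ := exists_isChart a
  rw [hc.regularAt_iff] at h
  exact hc.isOpenEmbedding.continuousAt_iff.1 h.continuousAt

theorem analyticAt_comp {u : ℂ → ℂ} (hu : AnalyticAt ℂ u (φ a)) (hφ : RegularAt φ a) :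
    RegularAt (fun x => u (φ x)) a := by
  obtain ⟨c, hc, z, rfl⟩ := exists_isChart a
  rw [hc.regularAt_iff] at hφ ⊢
  exact AnalyticAt.comp_of_eq hu hφ rfl

theorem analyticAt_comp₂ {u : ℂ × ℂ → ℂ} (hu : AnalyticAt ℂ u (φ a, ψ a)) (hφ : RegularAt φ a)
    (hψ : RegularAt ψ a) : RegularAt (fun x => u (φ x, ψ x)) a := by
  obtain ⟨c, hc, z, rfl⟩ := exists_isChart a
  rw [hc.regularAt_iff] at hφ hψ ⊢
  exact AnalyticAt.comp₂ hu hφ hψ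

theorem add (hφ : RegularAt φ a) (hψ : RegularAt ψ a) : RegularAt (fun x => φ x + ψ x) a :=
  analyticAt_comp₂ (u := fun p => p.1 + p.2) (analyticAt_fst.add analyticAt_snd) hφ hψ

theorem mul (hφ : RegularAt φ a) (hψ : RegularAt ψ a) : RegularAt (fun x => φ x * ψ x) a :=
  analyticAt_comp₂ (u := fun p => p.1 * p.2) (analyticAt_fst.mul analyticAt_snd) hφ hψ

theorem comp (hφ : RegularAt φ ((ψ a : ℂ) : Sphere)) (hψ : RegularAt ψ a) :
    RegularAt (fun x => φ ((ψ x : ℂ) : Sphere)) a :=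
  analyticAt_comp (u := fun w : ℂ => φ (w : Sphere)) (regularAt_coe.1 hφ) hψ

theorem eventuallyEq_or_eventually_ne (hφ : RegularAt φ a) (hψ : RegularAt ψ a) :
    φ =ᶠ[𝓝 a] ψ ∨ ∀ᶠ x in 𝓝[≠] a, φ x ≠ ψ x := by
  obtain ⟨c, hc, z, rfl⟩ := exists_isChart a
  rw [hc.regularAt_iff] at hφ hψ
  rw [EventuallyEq, hc.eventually_iff, hc.eventually_nhdsNE_iff]
  exact hφ.eventually_eq_or_eventually_ne hψ

theorem eventuallyEq_of_frequently (hφ : RegularAt φ a) (hψ : RegularAt ψ a)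
    (h : ∃ᶠ x in 𝓝[≠] a, φ x = ψ x) : φ =ᶠ[𝓝 a] ψ :=
  (hφ.eventuallyEq_or_eventually_ne hψ).resolve_right h

theorem eventually_eventuallyEq_iff (hφ : RegularAt φ a) (hψ : RegularAt ψ a) :
    ∀ᶠ x in 𝓝 a, (φ =ᶠ[𝓝 a] ψ ↔ φ =ᶠ[𝓝 x] ψ) := by
  rcases hφ.eventuallyEq_or_eventually_ne hψ with h | h
  · filter_upwards [eventually_eventually_nhds.2 h] with x hx using iff_of_true h hx
  · filter_upwards [eventually_nhdsWithin_iff.1 h] with x hx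
    rcases eq_or_ne x a with rfl | hxa
    · rfl
    · refine iff_of_false (fun h' => ?_) fun h' => hx hxa h'.eq_of_nhds
      obtain ⟨y, hy, hy'⟩ := ((h'.filter_mono nhdsWithin_le_nhds).and h).exists
      exact hy' hy

end RegularAt

theorem eventuallyEq_of_isPreconnected {C : Set Sphere} (hC : IsPreconnected C)
    (hφ : ∀ x ∈ C, RegularAt φ x) (hψ : ∀ x ∈ C, RegularAt ψ x) (ha : a ∈ C) (hb : b ∈ C)
    (h : φ =ᶠ[𝓝 a] ψ) : φ =ᶠ[𝓝 b] ψ :=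
  (iff_of_isPreconnected (Q := fun x => φ =ᶠ[𝓝 x] ψ) hC (fun x hx =>
    nhdsWithin_le_nhds ((hφ x hx).eventually_eventuallyEq_iff (hψ x hx))) ha hb).1 h

end RegularGerms

/-- `F` is an analytic continuation along `γ`, parametrized by real times, over the set of times
`T`: a regular germ at each `γ t`, locally constant in `t ∈ T`. -/
def IsContinuationOn (γ : ℝ → Sphere) (F : ℝ → Sphere → ℂ) (T : Set ℝ) : Prop :=
  ∀ t ∈ T, RegularAt (F t) (γ t) ∧ ∀ᶠ s in 𝓝[T] t, F s =ᶠ[𝓝 (γ s)] F t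

/-- Concatenation at time `m` of two functions of time. It is applied to paths and to families of
germs alike. -/
noncomputable def concat {α : Type*} (m : ℝ) (f g : ℝ → α) (t : ℝ) : α :=
  if t ≤ m then f t else g t

section Concat

variable {α : Type*} {m t : ℝ} {f g : ℝ → α}

theorem concat_of_le (ht : t ≤ m) : concat m f g t = f t := if_pos ht

theorem concat_of_lt (ht : m < t) : concat m f g t = g t := if_neg ht.not_ge

theorem concat_of_ge (h : f m = g m) (ht : m ≤ t) : concat m f g t = g t := by
  rcases ht.eq_or_lt with rfl | ht
  · rw [concat_of_le le_rfl, h]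
  · exact concat_of_lt ht

theorem concat_self (m : ℝ) (f : ℝ → α) : concat m f f = f := funext fun _ => ite_self _

theorem continuous_concat [TopologicalSpace α] (hf : Continuous f) (hg : Continuous g)
    (h : f m = g m) : Continuous (concat m f g) :=
  hf.if_le hg continuous_id continuous_const (by rintro t rfl; exact h)

end Concat

section Continuation

variable {γ δ : ℝ → Sphere} {F G : ℝ → Sphere → ℂ} {T T' : Set ℝ} {u m v : ℝ}

theorem isContinuationOn_const (h : ∀ t ∈ T, RegularAt φ (γ t)) :
    IsContinuationOn γ (fun _ => φ) T := fun t ht =>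
  ⟨h t ht, Eventually.of_forall fun _ => EventuallyEq.rfl⟩

namespace IsContinuationOn

theorem mono (h : IsContinuationOn γ F T) (hT : T' ⊆ T) : IsContinuationOn γ F T' := fun t ht =>
  ⟨(h t (hT ht)).1, nhdsWithin_mono _ hT (h t (hT ht)).2⟩

theorem congr (hγ : Continuous γ) (h : IsContinuationOn γ F T) (hγδ : EqOn δ γ T)
    (hFG : ∀ t ∈ T, G t =ᶠ[𝓝 (γ t)] F t) : IsContinuationOn δ G T := by
  intro t ht
  rw [hγδ ht]
  refine ⟨(h t ht).1.congr (hFG t ht).symm, ?_⟩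
  filter_upwards [(h t ht).2, self_mem_nhdsWithin, nhdsWithin_le_nhds
    (hγ.continuousAt.eventually (eventually_eventually_nhds.2 (hFG t ht)))] with s hs hsT hFGs
  rw [hγδ hsT]
  exact ((hFG s hsT).trans hs).trans (EventuallyEq.symm hFGs)

theorem comp (hF : IsContinuationOn γ F T) {k : ℝ → ℝ} (hk : Continuous k) (hT : MapsTo k T' T) :
    IsContinuationOn (fun t => γ (k t)) (fun t => F (k t)) T' := fun _ ht =>
  ⟨(hF _ (hT ht)).1, (hk.continuousWithinAt.tendsto_nhdsWithin hT).eventually (hF _ (hT ht)).2⟩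

theorem eventuallyEq (hγ : Continuous γ) (hF : IsContinuationOn γ F T)
    (hG : IsContinuationOn γ G T) (hT : IsPreconnected T) {t₀ t : ℝ} (h₀ : t₀ ∈ T) (ht : t ∈ T)
    (h : F t₀ =ᶠ[𝓝 (γ t₀)] G t₀) : F t =ᶠ[𝓝 (γ t)] G t := by
  refine (iff_of_isPreconnected (Q := fun t => F t =ᶠ[𝓝 (γ t)] G t) hT (fun r hr => ?_) h₀ ht).1 h
  have hr' : ∀ᶠ s in 𝓝[T] r, (F r =ᶠ[𝓝 (γ r)] G r ↔ F r =ᶠ[𝓝 (γ s)] G r) :=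
    nhdsWithin_le_nhds
      (hγ.continuousAt.eventually ((hF r hr).1.eventually_eventuallyEq_iff (hG r hr).1))
  filter_upwards [hr', (hF r hr).2, (hG r hr).2] with s hs hFs hGs
  exact hs.trans ⟨fun h => (hFs.trans h).trans hGs.symm, fun h => (hFs.symm.trans h).trans hGs⟩

theorem union (hT : IsClosed T) (hT' : IsClosed T') (h : IsContinuationOn γ F T)
    (h' : IsContinuationOn γ F T') : IsContinuationOn γ F (T ∪ T') := by
  have eventually_of_isClosed : ∀ {S : Set ℝ}, IsClosed S → IsContinuationOn γ F S →
      ∀ t, ∀ᶠ s in 𝓝[S] t, F s =ᶠ[𝓝 (γ s)] F t := by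
    intro S hS hF t
    by_cases ht : t ∈ S
    · exact (hF t ht).2
    · rw [notMem_closure_iff_nhdsWithin_eq_bot.1 (hS.closure_eq.symm ▸ ht)]
      exact eventually_bot
  refine fun t ht => ⟨ht.elim (fun ht => (h t ht).1) fun ht => (h' t ht).1, ?_⟩
  rw [nhdsWithin_union]
  exact eventually_sup.2 ⟨eventually_of_isClosed hT h t, eventually_of_isClosed hT' h' t⟩

theorem update {t₀ : ℝ} (h : IsContinuationOn γ F T) (hφ : RegularAt φ (γ t₀))
    (hF : ∀ᶠ s in 𝓝[T] t₀, F s =ᶠ[𝓝 (γ s)] φ) :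
    IsContinuationOn γ (Function.update F t₀ φ) (insert t₀ T) := by
  intro t ht
  rcases eq_or_ne t t₀ with rfl | hne
  · rw [Function.update_self, nhdsWithin_insert]
    refine ⟨hφ, eventually_sup.2 ⟨eventually_pure.2 (by rw [Function.update_self]), ?_⟩⟩
    filter_upwards [hF] with s hs
    rcases eq_or_ne s t with rfl | hst
    · rw [Function.update_self]
    · rwa [Function.update_of_ne hst]
  · rw [Function.update_of_ne hne, nhdsWithin_insert_of_ne hne]
    obtain ⟨hreg, hF⟩ := h t (ht.resolve_left hne)
    refine ⟨hreg, ?_⟩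
    filter_upwards [hF, nhdsWithin_le_nhds (isOpen_ne.mem_nhds hne)] with s hs hst
    rwa [Function.update_of_ne hst]

end IsContinuationOn

theorem isContinuationOn_concat (hγ : Continuous γ) (hδ : Continuous δ)
    (hF : IsContinuationOn γ F (Icc u m)) (hG : IsContinuationOn δ G (Icc m v)) (hγδ : γ m = δ m)
    (hFG : F m =ᶠ[𝓝 (γ m)] G m) (hum : u ≤ m) (hmv : m ≤ v) :
    IsContinuationOn (concat m γ δ) (concat m F G) (Icc u v) := by
  have hF' := hF.congr hγ (δ := concat m γ δ) (G := concat m F G)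
    (fun t ht => concat_of_le ht.2) fun t ht => by rw [concat_of_le ht.2]
  have hG' := hG.congr hδ (δ := concat m γ δ) (G := concat m F G)
    (fun t ht => concat_of_ge hγδ ht.1) fun t ht => by
      rcases ht.1.eq_or_lt with rfl | hmt
      · rwa [concat_of_le le_rfl, ← hγδ]
      · rw [concat_of_lt hmt]
  rw [← Icc_union_Icc_eq_Icc hum hmv]
  exact hF'.union isClosed_Icc isClosed_Icc hG'

end Continuation

section AvoidingCurves

variable {E : Type*} [NormedAddCommGroup E] [NormedSpace ℝ E] {O : Set ℝ}

open scoped Manifold ContDiff in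
theorem exists_contDiffAt_mem_of_convex (hO : IsOpen O) {t : ℝ → Set E}
    (ht : ∀ s ∈ O, Convex ℝ (t s)) (hloc : ∀ s ∈ O, ∃ q, ∀ᶠ r in 𝓝 s, q ∈ t r) (n : ℕ∞) :
    ∃ g : ℝ → E, ∀ s ∈ O, ContDiffAt ℝ n g s ∧ g s ∈ t s := by
  classical
  let U : TopologicalSpace.Opens ℝ := ⟨O, hO⟩
  have : LocallyCompactSpace U := hO.locallyCompactSpace
  obtain ⟨g, hg⟩ := exists_contMDiffMap_forall_mem_convex_of_local_const (n := n) 𝓘(ℝ, ℝ)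
    (t := fun s : U => t s) (fun s => ht s s.2) fun s =>
      (hloc s s.2).imp fun q hq => continuous_subtype_val.continuousAt.eventually hq
  let G : ℝ → E := fun s => if h : s ∈ O then g ⟨s, h⟩ else 0
  have hG (s : U) : G s = g s := dif_pos s.2
  refine ⟨G, fun s hs => ⟨contMDiffAt_iff_contDiffAt.1 ?_, hG ⟨s, hs⟩ ▸ hg ⟨s, hs⟩⟩⟩
  exact (contMDiffAt_subtype_iff (U := U) (x := ⟨s, hs⟩)).1
    ((g.contMDiff ⟨s, hs⟩).congr_of_eventuallyEq (Eventually.of_forall hG))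

/- For each `b ∈ B`, the directions `v` with `g s + η s • v = b` for some `s` form a `C¹` curve,
which has dimension at most one. -/
theorem exists_norm_lt_one_add_smul_notMem [FiniteDimensional ℝ E]
    (hE : 1 < Module.finrank ℝ E) {g : ℝ → E} {η : ℝ → ℝ} (hg : ∀ s ∈ O, ContDiffAt ℝ 1 g s)
    (hη : ∀ s ∈ O, ContDiffAt ℝ 1 η s) (hη₀ : ∀ s ∈ O, η s ≠ 0) {B : Set E} (hB : B.Countable) :
    ∃ v : E, ‖v‖ < 1 ∧ ∀ s ∈ O, g s + η s • v ∉ B := by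
  let f (b : E) (s : ℝ) : E := (η s)⁻¹ • (b - g s)
  have dimH_le_one (b : E) : dimH (f b '' O) ≤ 1 := by
    refine (dimH_image_le_of_locally_lipschitzOn fun s hs => ?_).trans
      ((dimH_mono (subset_univ O)).trans Real.dimH_univ.le)
    have hf : ContDiffAt ℝ 1 (f b) s :=
      ((hη s hs).inv (hη₀ s hs)).smul (contDiffAt_const.sub (hg s hs))
    obtain ⟨K, t, ht, hK⟩ := hf.exists_lipschitzOnWith
    exact ⟨K, t, mem_nhdsWithin_of_mem_nhds ht, hK⟩
  have hdim : dimH (⋃ b ∈ B, f b '' O) < Module.finrank ℝ E := by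
    rw [dimH_bUnion hB]
    exact (iSup₂_le fun b _ => dimH_le_one b).trans_lt (by exact_mod_cast hE)
  obtain ⟨v, hv, hvball⟩ := (dense_compl_of_dimH_lt_finrank hdim).exists_mem_open
    Metric.isOpen_ball ⟨(0 : E), Metric.mem_ball_self one_pos⟩
  refine ⟨v, mem_ball_zero_iff.1 hvball, fun s hs hmem => hv (mem_iUnion₂.2 ⟨_, hmem, s, hs, ?_⟩)⟩
  simp only [f, add_sub_cancel_left, inv_smul_smul₀ (hη₀ s hs)]

theorem convex_setOf_exists_dist_add_lt (w : E) (R : Set ℝ) :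
    Convex ℝ {q : E × ℝ | 0 < q.2 ∧ ∃ ρ ∈ R, dist q.1 w + q.2 < ρ} := by
  rintro ⟨p₁, η₁⟩ ⟨h₁, ρ₁, hρ₁, hlt₁⟩ ⟨p₂, η₂⟩ ⟨h₂, ρ₂, hρ₂, hlt₂⟩
  have hconv : ConvexOn ℝ univ fun q : E × ℝ => dist q.1 w + q.2 :=
    ((convexOn_univ_dist w).comp_linearMap (LinearMap.fst ℝ E ℝ)).add
      ((LinearMap.snd ℝ E ℝ).convexOn convex_univ)
  have hmax : max ρ₁ ρ₂ ∈ R := max_rec' (· ∈ R) hρ₁ hρ₂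
  intro x y hx hy hxy
  refine ⟨(convex_Ioi (0 : ℝ)) h₁ h₂ hx hy hxy, _, hmax, ?_⟩
  exact ((hconv.convex_lt (max ρ₁ ρ₂)) ⟨mem_univ _, lt_max_of_lt_left hlt₁⟩
    ⟨mem_univ _, lt_max_of_lt_right hlt₂⟩ hx hy hxy).2

theorem exists_avoiding_curve [FiniteDimensional ℝ E] (hE : 1 < Module.finrank ℝ E) (hO : IsOpen O)
    {w : ℝ → E} (hw : ContinuousOn w O) {B : Set E} (hB : B.Countable) {Q : ℝ → ℝ → Prop}
    (hQ : ∀ t ∈ O, ∃ ρ > 0, ∀ᶠ s in 𝓝 t, Q s ρ) :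
    ∃ p : ℝ → E, ContinuousOn p O ∧ ∀ s ∈ O, p s ∉ B ∧ ∃ ρ, Q s ρ ∧ dist (p s) (w s) < ρ := by
  have hloc : ∀ t ∈ O, ∃ q : E × ℝ,
      ∀ᶠ s in 𝓝 t, 0 < q.2 ∧ ∃ ρ, Q s ρ ∧ dist q.1 (w s) + q.2 < ρ := by
    intro t ht
    obtain ⟨ρ, hρ, hQρ⟩ := hQ t ht
    refine ⟨(w t, ρ / 2), ?_⟩
    have hwt : ∀ᶠ s in 𝓝 t, dist (w s) (w t) < ρ / 2 :=
      (hw.continuousAt (hO.mem_nhds ht)).eventually (Metric.ball_mem_nhds (w t) (half_pos hρ))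
    filter_upwards [hwt, hQρ] with s hs hQs
    refine ⟨half_pos hρ, ρ, hQs, ?_⟩
    rw [dist_comm]
    linarith
  obtain ⟨G, hG⟩ := exists_contDiffAt_mem_of_convex hO
    (fun s _ => convex_setOf_exists_dist_add_lt (w s) {ρ | Q s ρ}) hloc 1
  obtain ⟨v, hv, hvB⟩ := exists_norm_lt_one_add_smul_notMem hE
    (fun s hs => contDiffAt_fst.comp s (hG s hs).1) (fun s hs => contDiffAt_snd.comp s (hG s hs).1)
    (fun s hs => (hG s hs).2.1.ne') hB
  refine ⟨fun s => (G s).1 + (G s).2 • v, fun s hs => ?_, fun s hs => ⟨hvB s hs, ?_⟩⟩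
  · have hGs := (hG s hs).1.continuousAt
    exact (hGs.fst.add (hGs.snd.smul continuousAt_const)).continuousWithinAt
  · obtain ⟨hpos, ρ, hQρ, hlt⟩ := (hG s hs).2
    refine ⟨ρ, hQρ, lt_of_le_of_lt ?_ hlt⟩
    calc dist ((G s).1 + (G s).2 • v) (w s)
        ≤ dist ((G s).1 + (G s).2 • v) (G s).1 + dist (G s).1 (w s) := dist_triangle _ _ _
      _ = dist (G s).1 (w s) + (G s).2 * ‖v‖ := by
        rw [dist_self_add_left, norm_smul, Real.norm_of_nonneg hpos.le, add_comm]
      _ ≤ dist (G s).1 (w s) + (G s).2 := by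
        gcongr
        exact mul_le_of_le_one_right hpos.le hv.le

end AvoidingCurves

section InfDist

variable {X Y : Type*} [PseudoMetricSpace X] [PseudoMetricSpace Y] {O : Set X} {f g : X → Y}

theorem eventually_forall_dist_le_infDist_mem {t : X} (hf : ContinuousAt f t) (ht : t ∉ O)
    {V : Set Y} (hV : V ∈ 𝓝 (f t)) :
    ∀ᶠ s in 𝓝 t, ∀ y, dist y (f s) ≤ Metric.infDist s Oᶜ → y ∈ V := by
  obtain ⟨r, hr, hrV⟩ := Metric.mem_nhds_iff.1 hV
  have hdist : ∀ᶠ s in 𝓝 t, dist (f s) (f t) < r / 2 :=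
    hf.eventually (Metric.ball_mem_nhds _ (half_pos hr))
  have hinf : ∀ᶠ s in 𝓝 t, Metric.infDist s Oᶜ < r / 2 :=
    (Metric.continuous_infDist_pt Oᶜ).continuousAt.eventually
      (gt_mem_nhds ((Metric.infDist_zero_of_mem (mem_compl ht)).trans_lt (half_pos hr)))
  filter_upwards [hdist, hinf] with s hs hs' y hy
  refine hrV (Metric.mem_ball.2 ?_)
  linarith [dist_triangle y (f s) (f t)]

theorem continuous_of_dist_le_infDist (hf : Continuous f) (hO : IsOpen O) (hg : ContinuousOn g O)
    (hfg : EqOn g f Oᶜ) (hdist : ∀ s, dist (g s) (f s) ≤ Metric.infDist s Oᶜ) :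
    Continuous g := by
  refine continuous_iff_continuousAt.2 fun t => ?_
  by_cases ht : t ∈ O
  · exact hg.continuousAt (hO.mem_nhds ht)
  · refine fun V hV => mem_map.2 ?_
    rw [hfg ht] at hV
    filter_upwards [eventually_forall_dist_le_infDist_mem hf.continuousAt ht hV] with s hs
    exact hs _ (hdist s)

end InfDist

/-- `Φ` continues the germ `φ` from the point `c z` to the disc of radius `ρ` around it in the
chart `c`, and this disc is contained in a metric ball of radius `ε` of the sphere. -/
structure IsGermDisc (c : ℂ → Sphere) (ε : ℝ) (φ : Sphere → ℂ) (z : ℂ) (ρ : ℝ)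
    (Φ : Sphere → ℂ) : Prop where
  regularAt : ∀ y ∈ Metric.ball z ρ, RegularAt Φ (c y)
  eventuallyEq : Φ =ᶠ[𝓝 (c z)] φ
  dist_lt : ∀ y ∈ Metric.ball z ρ, dist (c y) (c z) < ε

/-- The path `γ'` with the germs `F'` along it is obtained from `γ` and `F` by a change at the times
in `O`, so small near the other times that a germ at such a time has the same continuations along
both paths. The family `F'` is again a continuation over `T`. -/
structure IsPerturbation (O T : Set ℝ) (γ γ' : ℝ → Sphere) (F F' : ℝ → Sphere → ℂ) : Prop where
  continuous : Continuous γ'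
  isContinuationOn : IsContinuationOn γ' F' T
  path_eq : ∀ t ∉ O, γ' t = γ t
  germ_eq : ∀ t ∉ O, F' t = F t
  eventually_iff : ∀ t ∉ O, ∀ Ψ, RegularAt Ψ (γ t) →
    ∀ᶠ s in 𝓝 t, (F s =ᶠ[𝓝 (γ s)] Ψ ↔ F' s =ᶠ[𝓝 (γ' s)] Ψ)

section Perturbation

variable {γ γ' γ'' : ℝ → Sphere} {F F' F'' : ℝ → Sphere → ℂ} {O T W : Set ℝ} {w p : ℝ → ℂ}

theorem IsChart.eventuallyEq_of_convex (hc : IsChart c) {S : Set ℂ} (hS : Convex ℝ S)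
    (hφ : ∀ x ∈ S, RegularAt φ (c x)) (hψ : ∀ x ∈ S, RegularAt ψ (c x)) {y z : ℂ} (hz : z ∈ S)
    (hy : y ∈ S) (h : φ =ᶠ[𝓝 (c z)] ψ) : φ =ᶠ[𝓝 (c y)] ψ :=
  eventuallyEq_of_isPreconnected
    (hS.isPreconnected.image _ hc.isOpenEmbedding.continuous.continuousOn)
    (forall_mem_image.2 hφ) (forall_mem_image.2 hψ) (mem_image_of_mem c hz)
    (mem_image_of_mem c hy) h

theorem IsGermDisc.eventuallyEq_iff {ε ρ : ℝ} {Φ : Sphere → ℂ} {y z : ℂ}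
    (h : IsGermDisc c ε φ z ρ Φ) (hc : IsChart c) {S : Set ℂ} (hS : Convex ℝ S)
    (hψ : ∀ x ∈ S, RegularAt ψ (c x)) (hz : z ∈ S) (hy : y ∈ Metric.ball z ρ) (hyS : y ∈ S) :
    φ =ᶠ[𝓝 (c z)] ψ ↔ Φ =ᶠ[𝓝 (c y)] ψ := by
  have hz' : z ∈ Metric.ball z ρ := Metric.mem_ball_self (Metric.pos_of_mem_ball hy)
  have transfer {x₁ x₂ : ℂ} := hc.eventuallyEq_of_convex ((convex_ball z ρ).inter hS)
    (fun x hx => h.regularAt x hx.1) (fun x hx => hψ x hx.2) (z := x₁) (y := x₂)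
  exact ⟨fun h' => transfer ⟨hz', hz⟩ ⟨hy, hyS⟩ (h.eventuallyEq.trans h'),
    fun h' => h.eventuallyEq.symm.trans (transfer ⟨hy, hyS⟩ ⟨hz', hz⟩ h')⟩

theorem IsContinuationOn.exists_isGermDisc (hF : IsContinuationOn γ F T) (hc : IsChart c) {t : ℝ}
    (ht : T ∈ 𝓝 t) (hw : ContinuousAt w t) (hcw : ∀ᶠ s in 𝓝 t, c (w s) = γ s) {ε : ℝ → ℝ}
    (hε : ContinuousAt ε t) (hεt : 0 < ε t) :
    ∃ ρ > 0, ∀ᶠ s in 𝓝 t, IsGermDisc c (ε s) (F s) (w s) ρ (F t) := by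
  obtain ⟨hreg, hFt⟩ := hF t (mem_of_mem_nhds ht)
  rw [nhdsWithin_eq_nhds.2 ht] at hFt
  have hball : ∀ᶠ z in 𝓝 (w t), RegularAt (F t) (c z) ∧ dist (c z) (c (w t)) < ε t / 3 :=
    hc.eventually_iff.1 ((hcw.self_of_nhds ▸ hreg.eventually).and
      (Metric.ball_mem_nhds _ (by positivity)))
  obtain ⟨r, hr, hr'⟩ := Metric.eventually_nhds_iff_ball.1 hball
  refine ⟨r / 2, half_pos hr, ?_⟩
  have hεs : ∀ᶠ s in 𝓝 t, 2 * (ε t / 3) < ε s := hε.eventually (lt_mem_nhds (by linarith))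
  filter_upwards [hFt, hcw, hεs, hw.eventually (Metric.ball_mem_nhds _ (half_pos hr))]
    with s hFs hcs hεs hws
  have hsub : Metric.ball (w s) (r / 2) ⊆ Metric.ball (w t) r :=
    Metric.ball_subset_ball' (by linarith)
  refine ⟨fun z hz => (hr' z (hsub hz)).1, hcs ▸ hFs.symm, fun z hz => ?_⟩
  have hz' := (hr' z (hsub hz)).2
  have hs' := (hr' (w s) (hsub (Metric.mem_ball_self (half_pos hr)))).2
  linarith [dist_triangle_right (c z) (c (w s)) (c (w t))]

namespace IsPerturbation

theorem mono {O' : Set ℝ} (h : IsPerturbation O T γ γ' F F') (hO : O ⊆ O') :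
    IsPerturbation O' T γ γ' F F' :=
  ⟨h.continuous, h.isContinuationOn, fun t ht => h.path_eq t (notMem_subset hO ht),
    fun t ht => h.germ_eq t (notMem_subset hO ht),
    fun t ht => h.eventually_iff t (notMem_subset hO ht)⟩

theorem trans (h : IsPerturbation O T γ γ' F F') (h' : IsPerturbation O T γ' γ'' F' F'') :
    IsPerturbation O T γ γ'' F F'' := by
  refine ⟨h'.continuous, h'.isContinuationOn, fun t ht => (h'.path_eq t ht).trans (h.path_eq t ht),
    fun t ht => (h'.germ_eq t ht).trans (h.germ_eq t ht), fun t ht Ψ hΨ => ?_⟩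
  filter_upwards [h.eventually_iff t ht Ψ hΨ,
    h'.eventually_iff t ht Ψ (by rwa [h.path_eq t ht])] with s hs hs' using hs.trans hs'

end IsPerturbation

section GermDiscs

variable [DecidablePred (· ∈ O)] {ρ : ℝ → ℝ} {Φ : ℝ → Sphere → ℂ}

theorem eventually_iff_of_isGermDisc (hc : IsChart c) (hγ : Continuous γ)
    (hcw : ∀ t ∈ O, c (w t) = γ t)
    (hΦ : ∀ t ∈ O, IsGermDisc c (Metric.infDist t Oᶜ) (F t) (w t) (ρ t) (Φ t))
    (hp : ∀ t ∈ O, p t ∈ Metric.ball (w t) (ρ t)) {t : ℝ} (ht : t ∉ O) (hψ : RegularAt ψ (γ t)) :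
    ∀ᶠ s in 𝓝 t, (F s =ᶠ[𝓝 (γ s)] ψ ↔
      O.piecewise Φ F s =ᶠ[𝓝 (O.piecewise (c ∘ p) γ s)] ψ) := by
  filter_upwards [eventually_forall_dist_le_infDist_mem hγ.continuousAt ht hψ.eventually] with s hs
  by_cases hsO : s ∈ O
  · rw [piecewise_eq_of_mem _ _ _ hsO, piecewise_eq_of_mem _ _ _ hsO, ← hcw s hsO]
    refine (hΦ s hsO).eventuallyEq_iff hc (convex_ball (w s) (ρ s)) (fun x hx => hs _ ?_)
      (Metric.mem_ball_self (Metric.pos_of_mem_ball (hp s hsO))) (hp s hsO) (hp s hsO)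
    rw [← hcw s hsO]
    exact ((hΦ s hsO).dist_lt x hx).le
  · rw [piecewise_eq_of_notMem _ _ _ hsO, piecewise_eq_of_notMem _ _ _ hsO]

theorem eventually_eventuallyEq_of_isGermDisc (hc : IsChart c) {t : ℝ}
    (hF : ∀ᶠ s in 𝓝 t, F s =ᶠ[𝓝 (c (w s))] F t) (hw : ContinuousAt w t) (hp : ContinuousAt p t)
    {ε : ℝ → ℝ} (hΦ : ∀ᶠ s in 𝓝 t, IsGermDisc c (ε s) (F s) (w s) (ρ s) (Φ s))
    (hpw : ∀ᶠ s in 𝓝 t, p s ∈ Metric.ball (w s) (ρ s)) :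
    ∀ᶠ s in 𝓝 t, Φ s =ᶠ[𝓝 (c (p s))] Φ t := by
  have hpt := hpw.self_of_nhds
  have hwt : ∀ᶠ s in 𝓝 t, w s ∈ Metric.ball (w t) (ρ t) :=
    hw.eventually (Metric.ball_mem_nhds _ (Metric.pos_of_mem_ball hpt))
  have hΦt : ∀ᶠ s in 𝓝 t, Φ t =ᶠ[𝓝 (c (w s))] F t :=
    (hc.isOpenEmbedding.continuous.continuousAt.comp hw).eventually
      (eventually_eventually_nhds.2 hΦ.self_of_nhds.eventuallyEq)
  filter_upwards [hF, hΦ, hpw, hwt, hΦt, hp.eventually (Metric.isOpen_ball.mem_nhds hpt)]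
    with s hFs hΦs hps hws hΦts hpts
  exact (hΦs.eventuallyEq_iff hc (convex_ball (w t) (ρ t)) hΦ.self_of_nhds.regularAt hws hps hpts).1
    (hFs.trans hΦts.symm)

theorem isPerturbation_of_isGermDisc (hc : IsChart c) (hγ : Continuous γ) (hO : IsOpen O)
    (hOT : O ⊆ T) (hF : IsContinuationOn γ F T) (hw : ContinuousOn w O)
    (hcw : ∀ t ∈ O, c (w t) = γ t) (hpO : ContinuousOn p O)
    (hΦ : ∀ t ∈ O, IsGermDisc c (Metric.infDist t Oᶜ) (F t) (w t) (ρ t) (Φ t))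
    (hp : ∀ t ∈ O, p t ∈ Metric.ball (w t) (ρ t)) :
    IsPerturbation O T γ (O.piecewise (c ∘ p) γ) F (O.piecewise Φ F) where
  continuous := by
    refine continuous_of_dist_le_infDist hγ hO
      ((hc.isOpenEmbedding.continuous.comp_continuousOn hpO).congr (piecewise_eqOn O _ _))
      (piecewise_eqOn_compl O _ _) fun s => ?_
    by_cases hs : s ∈ O
    · rw [piecewise_eq_of_mem _ _ _ hs, ← hcw s hs]
      exact ((hΦ s hs).dist_lt _ (hp s hs)).le
    · rw [piecewise_eq_of_notMem _ _ _ hs, dist_self]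
      exact Metric.infDist_nonneg
  isContinuationOn := by
    intro t htT
    obtain ⟨hreg, hFt⟩ := hF t htT
    by_cases ht : t ∈ O
    · have hOt := hO.mem_nhds ht
      rw [nhdsWithin_eq_nhds.2 (mem_of_superset hOt hOT)] at hFt
      rw [piecewise_eq_of_mem _ _ _ ht, piecewise_eq_of_mem _ _ _ ht]
      refine ⟨(hΦ t ht).regularAt _ (hp t ht), nhdsWithin_le_nhds ?_⟩
      filter_upwards [hOt, eventually_eventuallyEq_of_isGermDisc hc
        (by filter_upwards [hFt, hOt] with s hs hsO using hcw s hsO ▸ hs) (hw.continuousAt hOt)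
        (hpO.continuousAt hOt) (mem_of_superset hOt hΦ) (mem_of_superset hOt hp)] with s hs hΦs
      rwa [piecewise_eq_of_mem _ _ _ hs, piecewise_eq_of_mem _ _ _ hs]
    · rw [piecewise_eq_of_notMem _ _ _ ht, piecewise_eq_of_notMem _ _ _ ht]
      refine ⟨hreg, ?_⟩
      filter_upwards [hFt, nhdsWithin_le_nhds
        (eventually_iff_of_isGermDisc hc hγ hcw hΦ hp ht hreg)] with s hs hiff using hiff.1 hs
  path_eq t ht := piecewise_eq_of_notMem _ _ _ ht
  germ_eq t ht := piecewise_eq_of_notMem _ _ _ ht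
  eventually_iff _ ht _ hΨ := eventually_iff_of_isGermDisc hc hγ hcw hΦ hp ht hΨ

end GermDiscs

theorem exists_isPerturbation_in_chart (hc : IsChart c) (hA : A.Countable) (hγ : Continuous γ)
    (hW : IsOpen W) (hWc : Wᶜ.Nonempty) (hWT : W ⊆ T) (hF : IsContinuationOn γ F T) :
    ∃ γ' F', IsPerturbation (W ∩ γ ⁻¹' range c) T γ γ' F F' ∧
      ∀ t ∈ W ∩ γ ⁻¹' range c, γ' t ∉ A := by
  classical
  set O : Set ℝ := W ∩ γ ⁻¹' range c
  have hO : IsOpen O := hW.inter (hc.isOpenEmbedding.isOpen_range.preimage hγ)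
  have hOT : O ⊆ T := inter_subset_left.trans hWT
  let w : ℝ → ℂ := fun t => Function.invFun c (γ t)
  have hcw : ∀ t ∈ O, c (w t) = γ t := fun t ht => Function.invFun_eq ht.2
  have hw : ContinuousOn w O :=
    hc.isOpenEmbedding.isInducing.continuousOn_iff.2 (hγ.continuousOn.congr hcw)
  have hdisc : ∀ t ∈ O, ∃ ρ > 0, ∀ᶠ s in 𝓝 t,
      ∃ Φ, IsGermDisc c (Metric.infDist s Oᶜ) (F s) (w s) ρ Φ := by
    intro t ht
    have hOt := hO.mem_nhds ht
    obtain ⟨ρ, hρ, h⟩ := hF.exists_isGermDisc hc (mem_of_superset hOt hOT) (hw.continuousAt hOt)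
      (mem_of_superset hOt hcw) (Metric.continuous_infDist_pt Oᶜ).continuousAt
      ((hO.isClosed_compl.notMem_iff_infDist_pos
        (hWc.mono (compl_subset_compl.2 inter_subset_left))).1 (not_not.2 ht))
    exact ⟨ρ, hρ, h.mono fun s hs => ⟨F t, hs⟩⟩
  obtain ⟨p, hp, hpO⟩ := exists_avoiding_curve (by simp) hO hw
    (hA.preimage hc.isOpenEmbedding.injective) hdisc
  choose! ρ hΦ hpρ using fun s hs => (hpO s hs).2
  choose! Φ hΦ using hΦ
  refine ⟨_, _, isPerturbation_of_isGermDisc hc hγ hO hOT hF hw hcw hp hΦ hpρ, fun t ht => ?_⟩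
  rw [piecewise_eq_of_mem _ _ _ ht]
  exact (hpO t ht).1

theorem exists_isPerturbation (hA : A.Countable) (hγ : Continuous γ) (hW : IsOpen W)
    (hWc : Wᶜ.Nonempty) (hWT : W ⊆ T) (hF : IsContinuationOn γ F T) :
    ∃ γ' F', IsPerturbation W T γ γ' F F' ∧ ∀ t ∈ W, γ' t ∉ A := by
  obtain ⟨γ₁, F₁, h₁, hA₁⟩ := exists_isPerturbation_in_chart isChart_coe hA hγ hW hWc hWT hF
  obtain ⟨γ₂, F₂, h₂, hA₂⟩ := exists_isPerturbation_in_chart isChart_chartInfty hA h₁.continuous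
    hW hWc hWT h₁.isContinuationOn
  refine ⟨γ₂, F₂, (h₁.mono inter_subset_left).trans (h₂.mono inter_subset_left), fun t ht => ?_⟩
  by_cases h : γ₁ t ∈ range chartInfty
  · exact hA₂ t ⟨ht, h⟩
  · rw [h₂.path_eq t fun h' => h h'.2]
    refine hA₁ t ⟨ht, by_contra fun h' => ?_⟩
    rw [h₁.path_eq t fun h'' => h' h''.2] at h
    exact (mem_range_coe_or_mem_range_chartInfty (γ t)).elim h' h

end Perturbation

/-- The germ of `φ` at `a` continues along every path from `a` that does not meet `A`, except
possibly at its initial point. -/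
def IsForbidden (A : Set Sphere) (a : Sphere) (φ : Sphere → ℂ) : Prop :=
  ∀ γ : ℝ → Sphere, Continuous γ → ∀ u v : ℝ, u ≤ v → γ u = a → (∀ t ∈ Ioc u v, γ t ∉ A) →
    ∃ F, F u =ᶠ[𝓝 a] φ ∧ IsContinuationOn γ F (Icc u v)

/-- The germ of `ψ` at `b` is a continuation of the germ of `φ` at `a` along a path parametrized by
some interval of real times. -/
def Reaches (a : Sphere) (φ : Sphere → ℂ) (b : Sphere) (ψ : Sphere → ℂ) : Prop :=
  ∃ (γ : ℝ → Sphere) (F : ℝ → Sphere → ℂ) (u v : ℝ), Continuous γ ∧ u ≤ v ∧ γ u = a ∧ γ v = b ∧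
    IsContinuationOn γ F (Icc u v) ∧ F u =ᶠ[𝓝 a] φ ∧ F v =ᶠ[𝓝 b] ψ

section Reaches

variable {γ : ℝ → Sphere} {F : ℝ → Sphere → ℂ} {u v : ℝ}

theorem IsContinuation.isContinuationOn {γ : Path a b} {τ : I} {F : I → Sphere → ℂ}
    (h : IsContinuation γ τ φ F) :
    IsContinuationOn γ.extend (fun t => F (projIcc 0 1 zero_le_one t)) (Icc 0 τ) := by
  have hle : ∀ s ∈ Icc 0 (τ : ℝ), projIcc 0 1 zero_le_one s ≤ τ := fun s hs => by
    rw [projIcc_of_mem zero_le_one ⟨hs.1, hs.2.trans τ.2.2⟩]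
    exact hs.2
  intro t ht
  obtain ⟨hreg, hF⟩ := h.2 _ (hle t ht)
  refine ⟨hreg, ?_⟩
  filter_upwards [self_mem_nhdsWithin, nhdsWithin_le_nhds
    ((continuous_projIcc (h := zero_le_one)).continuousAt.eventually hF)] with s hsT hs
  exact hs (hle s hsT)

theorem IsContinuationOn.isContinuation {γ : Path a b}
    (h : IsContinuationOn γ.extend F (Icc 0 1)) (h₀ : F 0 =ᶠ[𝓝 a] φ) :
    IsContinuation γ 1 φ (fun t => F t) := by
  refine ⟨h₀, fun t _ => ?_⟩
  obtain ⟨hreg, hF⟩ := h t t.2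
  rw [Path.extend_apply γ t.2] at hreg
  refine ⟨hreg, ?_⟩
  filter_upwards [(continuous_subtype_val (p := fun x : ℝ => x ∈ I)).continuousAt.eventually
    (eventually_nhdsWithin_iff.1 hF)] with s hs _
  simpa only [Path.extend_apply γ s.2] using hs s.2

theorem Equivalent.reaches (h : Equivalent a φ b ψ) : Reaches a φ b ψ := by
  obtain ⟨γ, F, hF, hψ⟩ := h
  exact ⟨γ.extend, _, 0, 1, γ.continuous_extend, zero_le_one, γ.extend_zero, γ.extend_one,
    hF.isContinuationOn, by simpa using hF.1, by simpa using hψ⟩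

theorem IsContinuationOn.reaches (hF : IsContinuationOn γ F (Icc u v)) (hγ : Continuous γ)
    (huv : u ≤ v) : Reaches (γ u) (F u) (γ v) (F v) :=
  ⟨γ, F, u, v, hγ, huv, rfl, rfl, hF, EventuallyEq.rfl, EventuallyEq.rfl⟩

namespace Reaches

theorem regularAt (h : Reaches a φ b ψ) : RegularAt ψ b := by
  obtain ⟨γ, F, u, v, -, huv, -, rfl, hF, -, hψ⟩ := h
  exact (hF v (right_mem_Icc.2 huv)).1.congr hψ

theorem congr_left (h : Reaches a φ b ψ) (e : φ =ᶠ[𝓝 a] χ) : Reaches a χ b ψ := by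
  obtain ⟨γ, F, u, v, hγ, huv, hu, hv, hF, hφ, hψ⟩ := h
  exact ⟨γ, F, u, v, hγ, huv, hu, hv, hF, hφ.trans e, hψ⟩

theorem exists_ending_at (h : Reaches a φ b ψ) (v : ℝ) :
    ∃ γ F, ∃ u ≤ v, Continuous γ ∧ γ u = a ∧ γ v = b ∧ IsContinuationOn γ F (Icc u v) ∧
      F u =ᶠ[𝓝 a] φ ∧ F v =ᶠ[𝓝 b] ψ := by
  obtain ⟨γ, F, u₀, v₀, hγ, huv₀, hu₀, hv₀, hF, hφ, hψ⟩ := h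
  refine ⟨fun t => γ (t + (v₀ - v)), fun t => F (t + (v₀ - v)), u₀ - (v₀ - v), by linarith,
    by fun_prop, ?_, ?_, hF.comp (by fun_prop) fun t ht => ⟨?_, ?_⟩, ?_, ?_⟩
  · simpa only [sub_add_cancel]
  · simpa only [add_sub_cancel]
  · linarith [ht.1]
  · linarith [ht.2]
  · simpa only [sub_add_cancel]
  · simpa only [add_sub_cancel]

theorem trans {x : Sphere} (h : Reaches a φ b ψ) (h' : Reaches b ψ x χ) : Reaches a φ x χ := by
  obtain ⟨δ, G, m, v, hδ, hmv, hm, hv, hG, hψG, hχ⟩ := h'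
  obtain ⟨γ, F, u, hum, hγ, hu, hm', hF, hφ, hψF⟩ := h.exists_ending_at m
  have hγδ : γ m = δ m := hm'.trans hm.symm
  have hFG : F m =ᶠ[𝓝 (γ m)] G m := hm' ▸ hψF.trans hψG.symm
  refine ⟨concat m γ δ, concat m F G, u, v, continuous_concat hγ hδ hγδ, hum.trans hmv, ?_, ?_,
    isContinuationOn_concat hγ hδ hF hG hγδ hFG hum hmv, ?_, ?_⟩
  · rw [concat_of_le hum, hu]
  · rw [concat_of_ge hγδ hmv, hv]
  · rwa [concat_of_le hum]
  · rcases hmv.eq_or_lt with rfl | hmv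
    · rw [concat_of_le le_rfl]
      exact (by rwa [← hv, ← hγδ] : F m =ᶠ[𝓝 x] G m).trans hχ
    · rwa [concat_of_lt hmv]

theorem exists_avoiding (h : Reaches a φ b ψ) (hA : A.Countable) (v : ℝ) :
    ∃ γ F, ∃ u ≤ v, Continuous γ ∧ γ u = a ∧ γ v = b ∧ IsContinuationOn γ F (Icc u v) ∧
      F u =ᶠ[𝓝 a] φ ∧ F v =ᶠ[𝓝 b] ψ ∧ ∀ t ∈ Ioo u v, γ t ∉ A := by
  obtain ⟨γ, F, u, huv, hγ, hu, hv, hF, hφ, hψ⟩ := h.exists_ending_at v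
  have hu' : u ∉ Ioo u v := fun h => lt_irrefl _ h.1
  have hv' : v ∉ Ioo u v := fun h => lt_irrefl _ h.2
  obtain ⟨γ', F', hγ', hγ'A⟩ :=
    exists_isPerturbation hA hγ isOpen_Ioo ⟨u, hu'⟩ Ioo_subset_Icc_self hF
  refine ⟨γ', F', u, huv, hγ'.continuous, ?_, ?_, hγ'.isContinuationOn, ?_, ?_, hγ'A⟩
  · rw [hγ'.path_eq u hu', hu]
  · rw [hγ'.path_eq v hv', hv]
  · rwa [hγ'.germ_eq u hu']
  · rwa [hγ'.germ_eq v hv']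

end Reaches

end Reaches

section Forbidden

variable {γ : ℝ → Sphere} {F : ℝ → Sphere → ℂ} {u v : ℝ}

theorem exists_mem_Ioc_forall_Icc {p : ℝ → Prop} (h : ∀ᶠ t in 𝓝[≥] u, p t) (huv : u < v) :
    ∃ m ∈ Ioc u v, ∀ t ∈ Icc u m, p t := by
  obtain ⟨m, hum, hm⟩ := mem_nhdsGE_iff_exists_Icc_subset.1 h
  exact ⟨min m v, ⟨lt_min hum huv, min_le_right _ _⟩,
    fun t ht => hm ⟨ht.1, ht.2.trans (min_le_left _ _)⟩⟩

theorem exists_isContinuationOn_Ico (hγ : Continuous γ) (huv : u < v)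
    (h : ∀ r ∈ Ico u v, ∃ F, F u =ᶠ[𝓝 (γ u)] φ ∧ IsContinuationOn γ F (Icc u r)) :
    ∃ F, F u =ᶠ[𝓝 (γ u)] φ ∧ IsContinuationOn γ F (Ico u v) := by
  choose! G hGu hG using h
  refine ⟨fun t => G t t, hGu u (left_mem_Ico.2 huv),
    fun t ht => ⟨(hG t ht t (right_mem_Icc.2 ht.1)).1, ?_⟩⟩
  obtain ⟨r, htr, hrv⟩ := exists_between ht.2
  have hr : r ∈ Ico u v := ⟨ht.1.trans htr.le, hrv⟩
  have hGr : ∀ s ∈ Icc u r, G s s =ᶠ[𝓝 (γ s)] G r s := fun s hs => by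
    have hs' : s ∈ Ico u v := ⟨hs.1, hs.2.trans_lt hrv⟩
    exact IsContinuationOn.eventuallyEq hγ (hG s hs') ((hG r hr).mono (Icc_subset_Icc_right hs.2))
      isPreconnected_Icc (left_mem_Icc.2 hs.1) (right_mem_Icc.2 hs.1)
      ((hGu s hs').trans (hGu r hr).symm)
  rw [eventually_nhdsWithin_iff]
  filter_upwards [eventually_nhdsWithin_iff.1 (hG r hr t ⟨ht.1, htr.le⟩).2, gt_mem_nhds htr,
    hγ.continuousAt.eventually (eventually_eventually_nhds.2 (hGr t ⟨ht.1, htr.le⟩))]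
    with s hGs hsr hGts hsu
  have hs : s ∈ Icc u r := ⟨hsu.1, hsr.le⟩
  exact (hGr s hs).trans ((hGs hs).trans (EventuallyEq.symm hGts))

namespace IsForbidden

theorem mono {B : Set Sphere} (h : IsForbidden A a φ) (hAB : A ⊆ B) : IsForbidden B a φ :=
  fun γ hγ u v huv ha hB => h γ hγ u v huv ha fun t ht hA => hB t ht (hAB hA)

theorem congr (h : IsForbidden A a φ) (e : φ =ᶠ[𝓝 a] ψ) : IsForbidden A a ψ := by
  intro γ hγ u v huv ha hA
  obtain ⟨F, hF, hF'⟩ := h γ hγ u v huv ha hA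
  exact ⟨F, hF.trans e, hF'⟩

theorem of_reaches_of_notMem (h : IsForbidden A a φ) (hA : A.Countable) (hr : Reaches a φ b ψ)
    (hb : b ∉ A) : IsForbidden A b ψ := by
  intro δ hδ u v huv hu hδA
  obtain ⟨γ, F, u₀, hu₀, hγ, ha, hb', hF, hφ, hψ, hγA⟩ := hr.exists_avoiding hA u
  have hγδ : γ u = δ u := hb'.trans hu.symm
  have hκγ : ∀ t ≤ u, concat u γ δ t = γ t := fun t ht => concat_of_le ht
  have hκδ : ∀ t ≥ u, concat u γ δ t = δ t := fun t ht => concat_of_ge hγδ ht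
  have hκA : ∀ t ∈ Ioc u₀ v, concat u γ δ t ∉ A := by
    intro t ht
    rcases lt_trichotomy t u with htu | rfl | htu
    · exact hκγ t htu.le ▸ hγA t ⟨ht.1, htu⟩
    · rwa [hκγ t le_rfl, hb']
    · exact hκδ t htu.le ▸ hδA t ⟨htu, ht.2⟩
  obtain ⟨H, hHφ, hH⟩ := h _ (continuous_concat hγ hδ hγδ) u₀ v (hu₀.trans huv)
    ((hκγ u₀ hu₀).trans ha) hκA
  have hHγ : IsContinuationOn γ H (Icc u₀ u) :=
    (hH.mono (Icc_subset_Icc_right huv)).congr (continuous_concat hγ hδ hγδ)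
      (fun t ht => (hκγ t ht.2).symm) fun _ _ => EventuallyEq.rfl
  have hHF : H u =ᶠ[𝓝 (γ u)] F u := hHγ.eventuallyEq hγ hF isPreconnected_Icc
    (left_mem_Icc.2 hu₀) (right_mem_Icc.2 hu₀) (ha ▸ hHφ.trans hφ.symm)
  exact ⟨H, (hb' ▸ hHF).trans hψ, (hH.mono (Icc_subset_Icc_left hu₀)).congr
    (continuous_concat hγ hδ hγδ) (fun t ht => (hκδ t ht.1).symm) fun _ _ => EventuallyEq.rfl⟩

theorem of_reaches (h : IsForbidden A a φ) (hA : A.Countable) (hr : Reaches a φ b ψ) :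
    IsForbidden A b ψ := by
  rintro δ hδ u v huv rfl hδA
  rcases huv.eq_or_lt with rfl | huv
  · refine ⟨fun _ => ψ, EventuallyEq.rfl, isContinuationOn_const fun t ht => ?_⟩
    rw [Icc_self, mem_singleton_iff] at ht
    exact ht ▸ hr.regularAt
  obtain ⟨m, ⟨hum, hmv⟩, hm⟩ := exists_mem_Ioc_forall_Icc
    (nhdsWithin_le_nhds (hδ.continuousAt.eventually hr.regularAt.eventually)) huv
  have hconst : IsContinuationOn δ (fun _ => ψ) (Icc u m) := isContinuationOn_const hm
  have hforb : IsForbidden A (δ m) ψ :=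
    h.of_reaches_of_notMem hA (hr.trans (hconst.reaches hδ hum.le)) (hδA m ⟨hum, hmv⟩)
  obtain ⟨H, hHψ, hH⟩ := hforb δ hδ m v hmv rfl fun t ht => hδA t ⟨hum.trans ht.1, ht.2⟩
  refine ⟨concat m (fun _ => ψ) H, by rw [concat_of_le hum.le], ?_⟩
  have hH' := isContinuationOn_concat hδ hδ hconst hH rfl hHψ.symm hum.le hmv
  rwa [concat_self] at hH'

theorem exists_germ_at_end (h : IsForbidden A (γ u) φ) (hA : A.Countable) (hγ : Continuous γ)
    (huv : u < v) (hv : γ v ∉ A) (hF : IsContinuationOn γ F (Ico u v))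
    (hφ : F u =ᶠ[𝓝 (γ u)] φ) :
    ∃ ψ, RegularAt ψ (γ v) ∧ ∀ᶠ s in 𝓝[Ico u v] v, F s =ᶠ[𝓝 (γ s)] ψ := by
  have hu' : u ∉ Ioo u v := fun h => lt_irrefl _ h.1
  have hv' : v ∉ Ioo u v := fun h => lt_irrefl _ h.2
  obtain ⟨γ', F', hγ', hγ'A⟩ :=
    exists_isPerturbation hA hγ isOpen_Ioo ⟨u, hu'⟩ Ioo_subset_Ico_self hF
  have hγ'u : γ' u = γ u := hγ'.path_eq u hu'
  have hγ'v : γ' v = γ v := hγ'.path_eq v hv'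
  obtain ⟨G, hGφ, hG⟩ := h γ' hγ'.continuous u v huv.le hγ'u fun t ht => by
    rcases ht.2.eq_or_lt with rfl | htv
    exacts [hγ'v ▸ hv, hγ'A t ⟨ht.1, htv⟩]
  obtain ⟨hGreg, hGv⟩ := hG v (right_mem_Icc.2 huv.le)
  have hGF : ∀ s ∈ Ico u v, G s =ᶠ[𝓝 (γ' s)] F' s := fun s hs =>
    (hG.mono Ico_subset_Icc_self).eventuallyEq hγ'.continuous hγ'.isContinuationOn
      isPreconnected_Ico (left_mem_Ico.2 huv) hs
      (by rw [hγ'u, hγ'.germ_eq u hu']; exact hGφ.trans hφ.symm)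
  rw [hγ'v] at hGreg
  refine ⟨G v, hGreg, ?_⟩
  filter_upwards [nhdsWithin_le_nhds (hγ'.eventually_iff v hv' (G v) hGreg),
    nhdsWithin_mono v Ico_subset_Icc_self hGv, self_mem_nhdsWithin] with s hiff hGs hs
  exact hiff.2 ((hGF s hs).symm.trans hGs)

theorem mem_of_isSingularPoint (h : IsForbidden A a φ) (hA : A.Countable)
    (hs : IsSingularPoint a φ b) : b ∈ A := by
  obtain ⟨γ, hno, hγ⟩ := hs
  by_contra hb
  rw [← γ.extend_zero] at h
  rw [← γ.extend_one] at hb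
  obtain ⟨F, hφ, hF⟩ := exists_isContinuationOn_Ico γ.continuous_extend one_pos (φ := φ)
    fun r hr => by
      obtain ⟨F, hF⟩ := hγ ⟨r, hr.1, hr.2.le⟩ hr.2
      exact ⟨_, by simpa using hF.1, hF.isContinuationOn⟩
  obtain ⟨ψ, hψ, hFψ⟩ := h.exists_germ_at_end hA γ.continuous_extend one_pos hb hF hφ
  have hF' := hF.update hψ hFψ
  rw [Ico_insert_right zero_le_one] at hF'
  refine hno ⟨_, IsContinuationOn.isContinuation (F := Function.update F 1 ψ) hF' ?_⟩
  rw [Function.update_of_ne zero_ne_one]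
  simpa using hφ

end IsForbidden

end Forbidden

instance : LocallyConnectedSpace Sphere := by
  refine locallyConnectedSpace_iff_connected_subsets.2 fun a U hU => ?_
  obtain ⟨c, hc, z, rfl⟩ := exists_isChart a
  obtain ⟨r, hr, hrU⟩ := Metric.eventually_nhds_iff_ball.1 (hc.eventually_iff.1 hU)
  exact ⟨c '' Metric.ball z r, hc.isOpenEmbedding.image_mem_nhds.2 (Metric.ball_mem_nhds z hr),
    (convex_ball z r).isPreconnected.image _ hc.isOpenEmbedding.continuous.continuousOn,
    image_subset_iff.2 hrU⟩

theorem exists_countable_mem_forall_subset {α : Type*} {s : α → Set α} (hs : ∀ x, (s x).Countable)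
    (x₀ : α) : ∃ E : Set α, E.Countable ∧ x₀ ∈ E ∧ ∀ x ∈ E, s x ⊆ E := by
  let E : ℕ → Set α := fun n => (fun X => ⋃ x ∈ X, s x)^[n] {x₀}
  have hsucc : ∀ n, E (n + 1) = ⋃ x ∈ E n, s x := fun n => Function.iterate_succ_apply' _ n _
  have hE : ∀ n, (E n).Countable := by
    intro n
    induction n with
    | zero => exact countable_singleton x₀
    | succ n ih => exact hsucc n ▸ ih.biUnion fun x _ => hs x
  refine ⟨⋃ n, E n, countable_iUnion hE, mem_iUnion.2 ⟨0, rfl⟩, fun x hx y hy => ?_⟩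
  obtain ⟨n, hn⟩ := mem_iUnion.1 hx
  exact mem_iUnion.2 ⟨n + 1, hsucc n ▸ mem_biUnion hn hy⟩

/-- The direct continuation of the restriction of `ψ` to `W`, as a function which is holomorphic in
`V`. It is extended by zero to the rest of the sphere, to make it unique. -/
def directContinuations (V W : Set Sphere) (ψ : Sphere → ℂ) : Set (Sphere → ℂ) :=
  {χ | (∀ x ∈ V, RegularAt χ x) ∧ (∀ x ∉ V, χ x = 0) ∧ EqOn χ ψ W}

theorem subsingleton_directContinuations {V W : Set Sphere} (hV : IsPreconnected V)
    (hW : IsOpen W) (hne : W.Nonempty) (hWV : W ⊆ V) (ψ : Sphere → ℂ) :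
    (directContinuations V W ψ).Subsingleton := by
  rintro χ₁ ⟨hreg₁, hzero₁, heq₁⟩ χ₂ ⟨hreg₂, hzero₂, heq₂⟩
  obtain ⟨q, hq⟩ := hne
  have hgerm : χ₁ =ᶠ[𝓝 q] χ₂ :=
    eventuallyEq_of_mem (hW.mem_nhds hq) fun x hx => (heq₁ hx).trans (heq₂ hx).symm
  funext x
  by_cases hx : x ∈ V
  · exact (eventuallyEq_of_isPreconnected hV hreg₁ hreg₂ (hWV hq) hx hgerm).eq_of_nhds
  · rw [hzero₁ x hx, hzero₂ x hx]

theorem exists_countable_directContinuations (φ : Sphere → ℂ) :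
    ∃ S : Set (Set Sphere), TopologicalSpace.IsTopologicalBasis S ∧ ∃ E : Set (Sphere → ℂ),
      E.Countable ∧ φ ∈ E ∧ ∀ χ ∈ E, ∀ V ∈ S, ∀ W ∈ S, W.Nonempty → W ⊆ V →
        directContinuations V W χ ⊆ E := by
  obtain ⟨S, hS, hSc, hSb⟩ :=
    TopologicalSpace.IsTopologicalBasis.isOpen_isPreconnected (α := Sphere).exists_countable
  let step : (Sphere → ℂ) → Set (Sphere → ℂ) := fun χ =>
    ⋃ V ∈ S, ⋃ W ∈ {W ∈ S | W.Nonempty ∧ W ⊆ V}, directContinuations V W χ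
  have hstep : ∀ χ, (step χ).Countable := fun χ =>
    hSc.biUnion fun V hV => (hSc.mono (sep_subset _ _)).biUnion fun W hW =>
      (subsingleton_directContinuations (hS hV).2 (hS hW.1).1 hW.2.1 hW.2.2 χ).countable
  obtain ⟨E, hEc, hφ, hE⟩ := exists_countable_mem_forall_subset hstep φ
  exact ⟨S, hSb, E, hEc, hφ, fun χ hχ V hV W hW hne hWV _ h =>
    hE χ hχ (mem_biUnion hV (mem_biUnion ⟨hW, hne, hWV⟩ h))⟩

/-- **Poincaré–Volterra theorem** -/
theorem exists_countable_representatives (a : Sphere) (φ : Sphere → ℂ) :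
    ∃ E : Set (Sphere → ℂ), E.Countable ∧ ∀ b ψ, Reaches a φ b ψ → ∃ χ ∈ E, ψ =ᶠ[𝓝 b] χ := by
  obtain ⟨S, hS, E, hEc, hφE, hE⟩ := exists_countable_directContinuations φ
  refine ⟨E, hEc, ?_⟩
  rintro b ψ ⟨γ, F, u, v, hγ, huv, rfl, rfl, hF, hφ, hψ⟩
  suffices hv : ∃ χ ∈ E, F v =ᶠ[𝓝 (γ v)] χ by
    obtain ⟨χ, hχ, h⟩ := hv
    exact ⟨χ, hχ, hψ.symm.trans h⟩
  refine (iff_of_isPreconnected (Q := fun t => ∃ χ ∈ E, F t =ᶠ[𝓝 (γ t)] χ) isPreconnected_Icc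
    (fun t ht => ?_) (left_mem_Icc.2 huv) (right_mem_Icc.2 huv)).1 ⟨φ, hφE, hφ⟩
  obtain ⟨hreg, hFt⟩ := hF t ht
  obtain ⟨V, hV, htV, hVreg⟩ := hS.mem_nhds_iff.1 hreg.eventually
  have hVo : IsOpen V := hS.isOpen hV
  have hind : ∀ x ∈ V, V.indicator (F t) =ᶠ[𝓝 x] F t := fun x hx =>
    eventuallyEq_of_mem (hVo.mem_nhds hx) fun y hy => indicator_of_mem hy _
  have hEt : ∀ s, γ s ∈ V → (∃ χ ∈ E, F t =ᶠ[𝓝 (γ s)] χ) → ∃ χ ∈ E, F t =ᶠ[𝓝 (γ t)] χ := by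
    rintro s hsV ⟨χ, hχ, h⟩
    obtain ⟨W, hW, hsW, hWs⟩ := hS.mem_nhds_iff.1 (h.and (hVo.mem_nhds hsV))
    exact ⟨V.indicator (F t), hE χ hχ V hV W hW ⟨_, hsW⟩ (fun x hx => (hWs hx).2)
      ⟨fun x hx => (hVreg hx : RegularAt (F t) x).congr (hind x hx).symm,
        fun x hx => indicator_of_notMem hx _,
        fun x hx => (indicator_of_mem (hWs hx).2 _).trans (hWs hx).1⟩, (hind _ htV).symm⟩
  have hEs : (∃ χ ∈ E, F t =ᶠ[𝓝 (γ t)] χ) → ∀ᶠ s in 𝓝[Icc u v] t, ∃ χ ∈ E, F t =ᶠ[𝓝 (γ s)] χ := by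
    rintro ⟨χ, hχ, h⟩
    filter_upwards [nhdsWithin_le_nhds
      (hγ.continuousAt.eventually (eventually_eventually_nhds.2 h))] with s hs using ⟨χ, hχ, hs⟩
  have hsV : ∀ᶠ s in 𝓝[Icc u v] t, γ s ∈ V :=
    nhdsWithin_le_nhds (hγ.continuousAt.eventually (hVo.mem_nhds htV))
  by_cases hQ : ∃ χ ∈ E, F t =ᶠ[𝓝 (γ t)] χ
  · filter_upwards [hFt, hEs hQ] with s hs ⟨χ, hχ, h⟩ using iff_of_true hQ ⟨χ, hχ, hs.trans h⟩
  · filter_upwards [hFt, hsV] with s hs hsV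
    exact iff_of_false hQ fun ⟨χ, hχ, h⟩ => hQ (hEt s hsV ⟨χ, hχ, hs.symm.trans h⟩)

theorem countable_of_forall_eventually_notMem {X : Type*} [TopologicalSpace X]
    [SecondCountableTopology X] {Y : Set X} (h : ∀ x ∈ Y, ∀ᶠ y in 𝓝[≠] x, y ∉ Y) :
    Y.Countable := by
  refine (HereditarilyLindelofSpace.isLindelof Y).countable_of_isDiscrete
    (.of_nhdsWithin fun x hx => le_pure_iff.2 (mem_nhdsWithin_iff_eventually.2 ?_))
  filter_upwards [eventually_nhdsWithin_iff.1 (h x hx)] with y hy hyY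
  exact not_not.1 fun hyx => hy hyx hyY

namespace Reaches

theorem not_eventuallyEq_const {k : ℂ} (h : Reaches a φ b ψ) (hφ : ¬ φ =ᶠ[𝓝 a] fun _ => k) :
    ¬ ψ =ᶠ[𝓝 b] fun _ => k := by
  obtain ⟨γ, F, u, v, hγ, huv, rfl, rfl, hF, hFφ, hFψ⟩ := h
  refine fun hψ => hφ (hFφ.symm.trans ?_)
  exact hF.eventuallyEq hγ (G := fun _ _ => k)
    (isContinuationOn_const fun t _ => regularAt_const k _) isPreconnected_Icc
      (right_mem_Icc.2 huv) (left_mem_Icc.2 huv) (hFψ.trans hψ)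

theorem countable_setOf_apply_eq {k : ℂ} (hφ : ¬ φ =ᶠ[𝓝 a] fun _ => k) :
    {b | ∃ ψ, Reaches a φ b ψ ∧ ψ b = k}.Countable := by
  obtain ⟨E, hE, hEr⟩ := exists_countable_representatives a φ
  have hcount : ∀ χ : Sphere → ℂ, {b | χ b = k ∧ ∀ᶠ x in 𝓝[≠] b, χ x ≠ k}.Countable := fun χ =>
    countable_of_forall_eventually_notMem fun x hx => hx.2.mono fun y hy hy' => hy hy'.1
  refine (hE.biUnion fun χ _ => hcount χ).mono ?_
  rintro b ⟨ψ, hψ, hk⟩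
  obtain ⟨χ, hχE, hχ⟩ := hEr b ψ hψ
  refine mem_biUnion hχE ⟨hχ.eq_of_nhds ▸ hk, ?_⟩
  exact ((hψ.regularAt.congr hχ).eventuallyEq_or_eventually_ne (regularAt_const k b)).resolve_left
    fun h => hψ.not_eventuallyEq_const hφ (hχ.trans h)

end Reaches

section LocalContinuation

variable {γ : ℝ → Sphere} {F : ℝ → Sphere → ℂ} {P : ℝ → (Sphere → ℂ) → Prop} {u v : ℝ}

theorem IsContinuationOn.exists_extension {m s r : ℝ} (hγ : Continuous γ)
    (hF : IsContinuationOn γ F (Icc u s)) (hP : ∀ q ∈ Icc m s, P q (F q)) (hus : u ≤ s)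
    (hsr : s ≤ r) (hψF : ψ =ᶠ[𝓝 (γ s)] F s)
    (hψ : ∀ q ∈ Icc s r, RegularAt ψ (γ q) ∧ P q ψ) :
    ∃ G, G u = F u ∧ IsContinuationOn γ G (Icc u r) ∧ ∀ q ∈ Icc m r, P q (G q) := by
  have hG := isContinuationOn_concat hγ hγ hF
    (isContinuationOn_const (φ := ψ) fun q hq => (hψ q hq).1) rfl hψF.symm hus hsr
  rw [concat_self] at hG
  refine ⟨concat s F fun _ => ψ, concat_of_le hus, hG, fun q hq => ?_⟩
  rcases le_or_gt q s with hqs | hsq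
  · rw [concat_of_le hqs]
    exact hP q ⟨hq.1, hqs⟩
  · rw [concat_of_lt hsq]
    exact (hψ q ⟨hsq.le, hq.2⟩).2

theorem IsContinuationOn.exists_of_local {m : ℝ} (hγ : Continuous γ)
    (hF : IsContinuationOn γ F (Icc u m)) (hum : u ≤ m) (hmv : m ≤ v) (hP : P m (F m))
    (hloc : ∀ t ∈ Icc m v, ∃ J ∈ 𝓝[Icc m v] t, ∀ s ∈ J, ∀ ψ, RegularAt ψ (γ s) → P s ψ →
      ∃ ψ', ψ' =ᶠ[𝓝 (γ s)] ψ ∧ ∀ r ∈ J, RegularAt ψ' (γ r) ∧ P r ψ') :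
    ∃ G, G u = F u ∧ IsContinuationOn γ G (Icc u v) := by
  let Q : ℝ → Prop := fun t => ∃ G, G u = F u ∧ IsContinuationOn γ G (Icc u t) ∧
    ∀ r ∈ Icc m t, P r (G r)
  have Q_anti : ∀ s r, s ≤ r → Q r → Q s := by
    rintro s r hsr ⟨G, hGF, hG, hPG⟩
    exact ⟨G, hGF, hG.mono (Icc_subset_Icc_right hsr), fun q hq => hPG q ⟨hq.1, hq.2.trans hsr⟩⟩
  have Q_locally_const : ∀ t ∈ Icc m v, ∀ᶠ s in 𝓝[Icc m v] t, (Q t ↔ Q s) := by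
    intro t ht
    obtain ⟨J, hJ, hJloc⟩ := hloc t ht
    obtain ⟨ε, hε, hεJ⟩ := Metric.mem_nhdsWithin_iff.1 hJ
    have hord : OrdConnected (Metric.ball t ε ∩ Icc m v) := by
      rw [Real.ball_eq_Ioo]
      exact ordConnected_Ioo.inter ordConnected_Icc
    have Q_step : ∀ s ∈ Metric.ball t ε ∩ Icc m v, ∀ r ∈ Metric.ball t ε ∩ Icc m v,
        s ≤ r → Q s → Q r := by
      rintro s hs r hr hsr ⟨G, hGF, hG, hPG⟩
      have hus : u ≤ s := hum.trans hs.2.1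
      obtain ⟨ψ, hψG, hψ⟩ := hJloc s (hεJ hs) (G s) (hG s (right_mem_Icc.2 hus)).1
        (hPG s (right_mem_Icc.2 hs.2.1))
      obtain ⟨G', hG'G, hG'⟩ := hG.exists_extension hγ hPG hus hsr hψG fun q hq =>
        hψ q (hεJ (hord.out hs hr hq))
      exact ⟨G', hG'G.trans hGF, hG'⟩
    have ht' : t ∈ Metric.ball t ε ∩ Icc m v := ⟨Metric.mem_ball_self hε, ht⟩
    filter_upwards [inter_mem_nhdsWithin _ (Metric.ball_mem_nhds t hε)] with s hs
    rcases le_total t s with hts | hst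
    · exact ⟨Q_step t ht' s hs.symm hts, Q_anti t s hts⟩
    · exact ⟨Q_anti s t hst, Q_step s hs.symm t ht' hst⟩
  have hQm : Q m := ⟨F, rfl, hF, fun r hr => by rwa [le_antisymm hr.2 hr.1]⟩
  obtain ⟨G, hGF, hG, -⟩ := (iff_of_isPreconnected isPreconnected_Icc Q_locally_const
    (left_mem_Icc.2 hmv) (right_mem_Icc.2 hmv)).1 hQm
  exact ⟨G, hGF, hG⟩

theorem exists_isContinuationOn_of_local (hγ : Continuous γ) (huv : u ≤ v)
    (hχ : RegularAt χ (γ u)) (h₀ : ∀ᶠ r in 𝓝[Ioc u v] u, P r χ)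
    (hloc : ∀ t ∈ Ioc u v, ∃ J ∈ 𝓝[Ioc u v] t, ∀ s ∈ J, ∀ ψ, RegularAt ψ (γ s) → P s ψ →
      ∃ ψ', ψ' =ᶠ[𝓝 (γ s)] ψ ∧ ∀ r ∈ J, RegularAt ψ' (γ r) ∧ P r ψ') :
    ∃ F, F u =ᶠ[𝓝 (γ u)] χ ∧ IsContinuationOn γ F (Icc u v) := by
  rcases huv.eq_or_lt with rfl | huv
  · exact ⟨fun _ => χ, EventuallyEq.rfl, isContinuationOn_const fun t ht =>
      mem_singleton_iff.1 (Icc_self u ▸ ht) ▸ hχ⟩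
  rw [nhdsWithin_Ioc_eq_nhdsGT huv] at h₀
  obtain ⟨m₀, ⟨hum₀, hm₀v⟩, hm₀⟩ := exists_mem_Ioc_forall_Icc
    (nhdsWithin_le_nhds (hγ.continuousAt.eventually hχ.eventually)) huv
  obtain ⟨m, hPm, hum, hmm₀⟩ := (h₀.and (Ioc_mem_nhdsGT hum₀)).exists
  have hmv : Icc m v ⊆ Ioc u v := fun t ht => ⟨hum.trans_le ht.1, ht.2⟩
  have hconst : IsContinuationOn γ (fun _ => χ) (Icc u m) :=
    isContinuationOn_const fun t ht => hm₀ t ⟨ht.1, ht.2.trans hmm₀⟩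
  obtain ⟨F, hFχ, hF⟩ := hconst.exists_of_local hγ hum.le (hmm₀.trans hm₀v) hPm fun t ht =>
    (hloc t (hmv ht)).imp fun J hJ => ⟨nhdsWithin_mono t hmv hJ.1, hJ.2⟩
  exact ⟨F, hFχ ▸ EventuallyEq.rfl, hF⟩

theorem exists_isContinuationOn_of_Ioc (huv : u ≤ v) (hF : IsContinuationOn γ F (Ioc u v))
    (hχ : RegularAt χ (γ u)) (h : ∀ᶠ s in 𝓝[Ioc u v] u, F s =ᶠ[𝓝 (γ s)] χ) :
    ∃ F, F u =ᶠ[𝓝 (γ u)] χ ∧ IsContinuationOn γ F (Icc u v) := by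
  refine ⟨Function.update F u χ, by rw [Function.update_self], ?_⟩
  rw [← Ioc_insert_left huv]
  exact hF.update hχ h

namespace IsContinuationOn

theorem eventually_eventuallyEq_left (hF : IsContinuationOn γ F (Icc u v)) (hγ : Continuous γ)
    (huv : u ≤ v) (h₀ : F u =ᶠ[𝓝 (γ u)] φ) : ∀ᶠ s in 𝓝[Ioc u v] u, F s =ᶠ[𝓝 (γ s)] φ := by
  filter_upwards [nhdsWithin_mono u Ioc_subset_Icc_self (hF u (left_mem_Icc.2 huv)).2,
    nhdsWithin_le_nhds (hγ.continuousAt.eventually (eventually_eventually_nhds.2 h₀))] with s h₁ h₂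
  exact h₁.trans h₂

theorem reaches_of_mem {t : ℝ} (hF : IsContinuationOn γ F (Icc u v)) (hγ : Continuous γ)
    (h₀ : F u =ᶠ[𝓝 (γ u)] φ) (ht : t ∈ Icc u v) : Reaches (γ u) φ (γ t) (F t) :=
  ((hF.mono (Icc_subset_Icc_right ht.2)).reaches hγ ht.1).congr_left h₀

end IsContinuationOn

end LocalContinuation

section Arithmetic

namespace IsContinuationOn

variable {γ δ : ℝ → Sphere} {F G : ℝ → Sphere → ℂ} {T : Set ℝ}

theorem analyticAt_comp₂ {e : ℂ × ℂ → ℂ} (hF : IsContinuationOn γ F T)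
    (hG : IsContinuationOn γ G T) (he : ∀ t ∈ T, AnalyticAt ℂ e (F t (γ t), G t (γ t))) :
    IsContinuationOn γ (fun t x => e (F t x, G t x)) T := fun t ht =>
  ⟨RegularAt.analyticAt_comp₂ (he t ht) (hF t ht).1 (hG t ht).1, by
    filter_upwards [(hF t ht).2, (hG t ht).2] with s hFs hGs
    filter_upwards [hFs, hGs] with x hFx hGx
    rw [hFx, hGx]⟩

theorem continuousOn_apply (hγ : Continuous γ) (hF : IsContinuationOn γ F T) :
    ContinuousOn (fun t => F t (γ t)) T := by
  intro t ht
  have hFt : ContinuousWithinAt (fun s => F t (γ s)) T t :=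
    ((hF t ht).1.continuousAt.comp hγ.continuousAt).continuousWithinAt
  refine hFt.congr_of_eventuallyEq ?_ rfl
  filter_upwards [(hF t ht).2] with s hs using hs.eq_of_nhds

theorem comp_germ (hG : IsContinuationOn γ G T) (hF : IsContinuationOn δ F T)
    (hδ : ∀ t ∈ T, δ t = (G t (γ t) : ℂ)) :
    IsContinuationOn γ (fun t x => F t ((G t x : ℂ) : Sphere)) T := by
  intro t ht
  refine ⟨RegularAt.comp (hδ t ht ▸ (hF t ht).1) (hG t ht).1, ?_⟩
  filter_upwards [(hF t ht).2, (hG t ht).2, self_mem_nhdsWithin] with s hFs hGs hs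
  rw [hδ s hs] at hFs
  filter_upwards [hGs, (OnePoint.continuous_coe.continuousAt.comp
    (hG s hs).1.continuousAt).eventually hFs] with x hGx hFx
  rw [← hGx]
  exact hFx

end IsContinuationOn

theorem isForbidden_const (A : Set Sphere) (k : ℂ) (a : Sphere) : IsForbidden A a fun _ => k :=
  fun _ _ _ _ _ _ _ => ⟨fun _ _ => k, EventuallyEq.rfl,
    isContinuationOn_const fun _ _ => regularAt_const k _⟩

namespace IsForbidden

theorem regularAt (h : IsForbidden A a φ) : RegularAt φ a := by
  obtain ⟨F, hFφ, hF⟩ := h (fun _ => a) continuous_const 0 0 le_rfl rfl (by simp)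
  exact (hF 0 (left_mem_Icc.2 le_rfl)).1.congr hFφ

theorem entire_comp₂ {e : ℂ × ℂ → ℂ} (he : ∀ p, AnalyticAt ℂ e p) (hφ : IsForbidden A a φ)
    (hψ : IsForbidden A a ψ) : IsForbidden A a fun x => e (φ x, ψ x) := by
  intro γ hγ u v huv ha hA
  obtain ⟨F, hFφ, hF⟩ := hφ γ hγ u v huv ha hA
  obtain ⟨G, hGψ, hG⟩ := hψ γ hγ u v huv ha hA
  refine ⟨_, ?_, hF.analyticAt_comp₂ hG fun t _ => he _⟩
  filter_upwards [hFφ, hGψ] with x hFx hGx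
  rw [hFx, hGx]

theorem entire_comp {e : ℂ → ℂ} (he : ∀ z, AnalyticAt ℂ e z) (hφ : IsForbidden A a φ) :
    IsForbidden A a fun x => e (φ x) :=
  entire_comp₂ (fun _ => AnalyticAt.comp (he _) analyticAt_fst) hφ hφ

theorem add (hφ : IsForbidden A a φ) (hψ : IsForbidden A a ψ) :
    IsForbidden A a fun x => φ x + ψ x :=
  entire_comp₂ (e := fun p => p.1 + p.2) (fun _ => analyticAt_fst.add analyticAt_snd) hφ hψ

theorem sub (hφ : IsForbidden A a φ) (hψ : IsForbidden A a ψ) :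
    IsForbidden A a fun x => φ x - ψ x :=
  entire_comp₂ (e := fun p => p.1 - p.2) (fun _ => analyticAt_fst.sub analyticAt_snd) hφ hψ

theorem mul (hφ : IsForbidden A a φ) (hψ : IsForbidden A a ψ) :
    IsForbidden A a fun x => φ x * ψ x :=
  entire_comp₂ (e := fun p => p.1 * p.2) (fun _ => analyticAt_fst.mul analyticAt_snd) hφ hψ

theorem div (hφ : IsForbidden A a φ) (hψ : IsForbidden A a ψ) (hχ : RegularAt χ a)
    (h : ∀ᶠ x in 𝓝 a, χ x * ψ x = φ x) :
    IsForbidden (A ∪ {b | ∃ ψ', Reaches a ψ b ψ' ∧ ψ' b = 0}) a χ := by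
  rintro γ hγ u v huv rfl hA
  obtain ⟨F, hFφ, hF⟩ := hφ γ hγ u v huv rfl fun t ht h => hA t ht (Or.inl h)
  obtain ⟨G, hGψ, hG⟩ := hψ γ hγ u v huv rfl fun t ht h => hA t ht (Or.inl h)
  have hG_ne : ∀ t ∈ Ioc u v, G t (γ t) ≠ 0 := fun t ht h0 =>
    hA t ht (Or.inr ⟨G t, hG.reaches_of_mem hγ hGψ (Ioc_subset_Icc_self ht), h0⟩)
  refine exists_isContinuationOn_of_Ioc huv ((hF.mono Ioc_subset_Icc_self).analyticAt_comp₂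
    (e := fun p => p.1 / p.2) (hG.mono Ioc_subset_Icc_self)
    fun t ht => analyticAt_fst.div analyticAt_snd (hG_ne t ht)) hχ ?_
  filter_upwards [hF.eventually_eventuallyEq_left hγ huv hFφ,
    hG.eventually_eventuallyEq_left hγ huv hGψ, self_mem_nhdsWithin,
    nhdsWithin_le_nhds (hγ.continuousAt.eventually (eventually_eventually_nhds.2 h))]
    with s hFs hGs hs hχs
  filter_upwards [hFs, hGs, hχs, (hG s (Ioc_subset_Icc_self hs)).1.continuousAt.eventually_ne
    (hG_ne s hs)] with x hFx hGx hχx hne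
  rw [hFx, ← hχx, ← hGx, mul_div_cancel_right₀ _ hne]

theorem comp {B : Set Sphere} (hφ : IsForbidden B ((ψ a : ℂ) : Sphere) φ)
    (hψ : IsForbidden A a ψ) :
    IsForbidden (A ∪ {b | ∃ ψ', Reaches a ψ b ψ' ∧ ((ψ' b : ℂ) : Sphere) ∈ B}) a
      (fun x => φ ((ψ x : ℂ) : Sphere)) := by
  rintro γ hγ u v huv rfl hA
  obtain ⟨G, hGψ, hG⟩ := hψ γ hγ u v huv rfl fun t ht h => hA t ht (Or.inl h)
  obtain ⟨δ, hδ, hδG⟩ : ∃ δ : ℝ → Sphere, Continuous δ ∧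
      ∀ t ∈ Icc u v, δ t = (G t (γ t) : ℂ) := by
    have hcont := OnePoint.continuous_coe.comp_continuousOn (hG.continuousOn_apply hγ)
    exact ⟨_, (continuousOn_iff_continuous_domRestrict.1 hcont).Icc_extend' (h := huv),
      fun t ht => IccExtend_of_mem huv _ ht⟩
  have hu : δ u = ((ψ (γ u) : ℂ) : Sphere) := by
    rw [hδG u (left_mem_Icc.2 huv), hGψ.eq_of_nhds]
  obtain ⟨F, hFφ, hF⟩ := hφ δ hδ u v huv hu fun t ht h => hA t ht (Or.inr
    ⟨G t, hG.reaches_of_mem hγ hGψ (Ioc_subset_Icc_self ht), hδG t (Ioc_subset_Icc_self ht) ▸ h⟩)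
  refine ⟨_, ?_, hG.comp_germ hF hδG⟩
  filter_upwards [hGψ, (OnePoint.continuous_coe.continuousAt.comp
    hψ.regularAt.continuousAt).eventually hFφ] with x hGx hFx
  rw [hGx]
  exact hFx

end IsForbidden

end Arithmetic

section Calculus

/-- The finite coordinate of a point of the sphere, with the junk value `0` at `∞`. -/
noncomputable def finiteCoord (x : Sphere) : ℂ := OnePoint.elim x 0 id

theorem finiteCoord_coe (z : ℂ) : finiteCoord (z : Sphere) = z := rfl

/-- The derivative of `φ` in the finite coordinate, meaningful at finite points only. -/
noncomputable def finiteDeriv (φ : Sphere → ℂ) (x : Sphere) : ℂ :=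
  deriv (fun w : ℂ => φ w) (finiteCoord x)

theorem RegularAt.isDerivativeNear_finiteDeriv (h : RegularAt φ a) (ha : a ≠ OnePoint.infty) :
    IsDerivativeNear a φ (finiteDeriv φ) := by
  obtain ⟨z, rfl⟩ := OnePoint.ne_infty_iff_exists.1 ha
  rw [regularAt_coe] at h
  refine isChart_coe.eventually_iff.2 ?_
  filter_upwards [h.eventually_analyticAt] with w hw z hz
  obtain rfl : w = z := OnePoint.coe_injective hz
  exact hw.differentiableAt.hasDerivAt

theorem RegularAt.finiteDeriv (h : RegularAt φ a) (ha : a ≠ OnePoint.infty) :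
    RegularAt (finiteDeriv φ) a := by
  obtain ⟨z, rfl⟩ := OnePoint.ne_infty_iff_exists.1 ha
  exact regularAt_coe.2 (regularAt_coe.1 h).deriv

theorem RegularAt.exists_primitive (h : RegularAt φ a) (ha : a ≠ OnePoint.infty) :
    ∃ p, RegularAt p a ∧ IsDerivativeNear a p φ := by
  obtain ⟨z, rfl⟩ := OnePoint.ne_infty_iff_exists.1 ha
  obtain ⟨r, hr, hφ⟩ :=
    Metric.eventually_nhds_iff_ball.1 (regularAt_coe.1 h).eventually_analyticAt
  obtain ⟨p, hp⟩ := DifferentiableOn.isExactOn_ball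
    fun w hw => (hφ w hw).differentiableAt.differentiableWithinAt
  refine ⟨fun x => p (finiteCoord x), regularAt_coe.2 ?_, isChart_coe.eventually_iff.2 ?_⟩
  · exact DifferentiableOn.analyticAt (s := Metric.ball z r)
      (fun w hw => (hp w hw).differentiableAt.differentiableWithinAt) (Metric.ball_mem_nhds z hr)
  · filter_upwards [Metric.ball_mem_nhds z hr] with w hw z hz
    obtain rfl : w = z := OnePoint.coe_injective hz
    exact hp w hw

namespace IsDerivativeNear

theorem congr (h : IsDerivativeNear a φ χ) {φ' χ' : Sphere → ℂ} (hφ : φ =ᶠ[𝓝 a] φ')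
    (hχ : χ =ᶠ[𝓝 a] χ') : IsDerivativeNear a φ' χ' := by
  filter_upwards [h, eventually_eventually_nhds.2 hφ, hχ]
  rintro _ hx hφx hχx z rfl
  rw [← hχx]
  exact (hx z rfl).congr_of_eventuallyEq (EventuallyEq.symm (isChart_coe.eventually_iff.1 hφx))

theorem eventually (h : IsDerivativeNear a φ χ) : ∀ᶠ x in 𝓝 a, IsDerivativeNear x φ χ :=
  eventually_eventually_nhds.2 h

theorem add_const (h : IsDerivativeNear a φ χ) (k : ℂ) :
    IsDerivativeNear a (fun x => φ x + k) χ := by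
  filter_upwards [h] with x hx z hz using (hx z hz).add_const k

theorem eventuallyEq (h : IsDerivativeNear a φ χ) (h' : IsDerivativeNear a φ ψ)
    (ha : a ≠ OnePoint.infty) : χ =ᶠ[𝓝 a] ψ := by
  filter_upwards [h, h', isOpen_compl_singleton.mem_nhds ha] with x hx hx' hfin
  obtain ⟨z, hz⟩ := OnePoint.ne_infty_iff_exists.1 hfin
  exact (hx z hz.symm).unique (hx' z hz.symm)

theorem eventuallyEq_add_const (h : IsDerivativeNear a φ χ) (h' : IsDerivativeNear a ψ χ)
    (ha : a ≠ OnePoint.infty) : ∃ k, φ =ᶠ[𝓝 a] fun x => ψ x + k := by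
  obtain ⟨z, rfl⟩ := OnePoint.ne_infty_iff_exists.1 ha
  obtain ⟨r, hr, hD⟩ := Metric.eventually_nhds_iff_ball.1
    ((isChart_coe.eventually_iff.1 h).and (isChart_coe.eventually_iff.1 h'))
  have hderiv : ∀ w ∈ Metric.ball z r, HasDerivAt (fun w : ℂ => φ w - ψ w) 0 w := fun w hw =>
    sub_self (χ w) ▸ ((hD w hw).1 w rfl).sub ((hD w hw).2 w rfl)
  obtain ⟨k, hk⟩ := Metric.isOpen_ball.exists_is_const_of_deriv_eq_zero
    (convex_ball z r).isPreconnected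
    (fun w hw => (hderiv w hw).differentiableAt.differentiableWithinAt)
    fun w hw => (hderiv w hw).deriv
  refine ⟨k, isChart_coe.eventually_iff.2 ?_⟩
  filter_upwards [Metric.ball_mem_nhds z hr] with w hw using sub_eq_iff_eq_add'.1 (hk w hw)

end IsDerivativeNear

section

variable {γ : ℝ → Sphere} {F : ℝ → Sphere → ℂ} {T : Set ℝ} {u v : ℝ}

theorem IsContinuationOn.finiteDeriv (hF : IsContinuationOn γ F T)
    (hfin : ∀ t ∈ T, γ t ≠ OnePoint.infty) :
    IsContinuationOn γ (fun t => FiniteTerms.finiteDeriv (F t)) T := by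
  refine fun t ht => ⟨(hF t ht).1.finiteDeriv (hfin t ht), ?_⟩
  filter_upwards [(hF t ht).2, self_mem_nhdsWithin] with s hs hsT
  have hs' := (hF s hsT).1.isDerivativeNear_finiteDeriv (hfin s hsT)
  exact hs'.eventuallyEq ((((hF s hsT).1.congr hs).isDerivativeNear_finiteDeriv
    (hfin s hsT)).congr hs.symm EventuallyEq.rfl) (hfin s hsT)

theorem exists_isContinuationOn_of_isDerivativeNear (hγ : Continuous γ) (huv : u ≤ v)
    (hχ : RegularAt χ (γ u)) (hF : IsContinuationOn γ F (Ioc u v))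
    (hfin : ∀ t ∈ Ioc u v, γ t ≠ OnePoint.infty)
    (h : ∀ᶠ s in 𝓝[Ioc u v] u, IsDerivativeNear (γ s) χ (F s)) :
    ∃ H, H u =ᶠ[𝓝 (γ u)] χ ∧ IsContinuationOn γ H (Icc u v) := by
  refine exists_isContinuationOn_of_local hγ huv hχ
    (P := fun s ψ => IsDerivativeNear (γ s) ψ (F s)) h fun t ht => ?_
  obtain ⟨hreg, hFt⟩ := hF t ht
  obtain ⟨p, hp, hpF⟩ := hreg.exists_primitive (hfin t ht)
  have hpγ : ∀ᶠ s in 𝓝 t, RegularAt p (γ s) ∧ IsDerivativeNear (γ s) p (F t) :=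
    hγ.continuousAt.eventually (hp.eventually.and hpF.eventually)
  refine ⟨_, inter_mem (inter_mem (nhdsWithin_le_nhds hpγ) hFt) self_mem_nhdsWithin, ?_⟩
  rintro s ⟨⟨⟨-, hps⟩, hFs⟩, hs⟩ ψ - hψ
  obtain ⟨k, hk⟩ :=
    (hψ.congr EventuallyEq.rfl hFs).eventuallyEq_add_const hps (hfin s hs)
  refine ⟨fun x => p x + k, hk.symm, ?_⟩
  rintro r ⟨⟨⟨hpr, hpr'⟩, hFr⟩, -⟩
  exact ⟨hpr.add (regularAt_const k _), (hpr'.congr EventuallyEq.rfl hFr.symm).add_const k⟩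

end

namespace IsForbidden

theorem deriv (hφ : IsForbidden A a φ) (hχ : RegularAt χ a) (h : IsDerivativeNear a φ χ) :
    IsForbidden (A ∪ {OnePoint.infty}) a χ := by
  rintro γ hγ u v huv rfl hA
  obtain ⟨F, hFφ, hF⟩ := hφ γ hγ u v huv rfl fun t ht h => hA t ht (Or.inl h)
  have hfin : ∀ t ∈ Ioc u v, γ t ≠ OnePoint.infty := fun t ht h => hA t ht (Or.inr h)
  refine exists_isContinuationOn_of_Ioc huv
    ((hF.mono Ioc_subset_Icc_self).finiteDeriv hfin) hχ ?_
  filter_upwards [hF.eventually_eventuallyEq_left hγ huv hFφ, self_mem_nhdsWithin,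
    nhdsWithin_le_nhds (hγ.continuousAt.eventually h.eventually)] with s hFs hs hχs
  exact ((hF s (Ioc_subset_Icc_self hs)).1.isDerivativeNear_finiteDeriv (hfin s hs)).eventuallyEq
    (hχs.congr hFs.symm EventuallyEq.rfl) (hfin s hs)

theorem integral (hφ : IsForbidden A a φ) (hχ : RegularAt χ a) (h : IsDerivativeNear a χ φ) :
    IsForbidden (A ∪ {OnePoint.infty}) a χ := by
  rintro γ hγ u v huv rfl hA
  obtain ⟨F, hFφ, hF⟩ := hφ γ hγ u v huv rfl fun t ht h => hA t ht (Or.inl h)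
  refine exists_isContinuationOn_of_isDerivativeNear hγ huv hχ (hF.mono Ioc_subset_Icc_self)
    (fun t ht h => hA t ht (Or.inr h)) ?_
  filter_upwards [hF.eventually_eventuallyEq_left hγ huv hFφ,
    nhdsWithin_le_nhds (hγ.continuousAt.eventually h.eventually)] with s hFs hχs
  exact hχs.congr EventuallyEq.rfl hFs.symm

end IsForbidden

end Calculus

section SimpleRoots

open Polynomial

theorem exists_map_eq_C_mul {R K : Type*} [CommRing R] [IsDomain R] [Field K] [Algebra R K]
    [IsFractionRing R K] (p : K[X]) :
    ∃ s : R, s ≠ 0 ∧ ∃ P : R[X], P.map (algebraMap R K) = C (algebraMap R K s) * p := by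
  obtain ⟨s, hs, hP⟩ := IsLocalization.integerNormalization_spec (nonZeroDivisors R) p
  exact ⟨s, nonZeroDivisors.ne_zero hs, _,
    hP.trans (by rw [← algebraMap_smul K, smul_eq_C_mul])⟩

theorem exists_coprime_derivative {R O : Type*} [CommRing R] [IsDomain R] [CharZero R] [CommRing O]
    [IsDomain O] [Algebra R O] [FaithfulSMul R O] {x : O} (hx : IsAlgebraic R x) :
    ∃ (Q U V : R[X]) (r : R), r ≠ 0 ∧ Q ≠ 0 ∧ aeval x Q = 0 ∧ U * Q + V * derivative Q = C r := by
  let K := FractionRing R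
  let L := FractionRing O
  have : FaithfulSMul R L := by
    rw [faithfulSMul_iff_algebraMap_injective, IsScalarTower.algebraMap_eq R O L]
    exact (IsFractionRing.injective O L).comp (FaithfulSMul.algebraMap_injective R O)
  let _ : Algebra K L := FractionRing.liftAlgebra R L
  have : IsScalarTower R K L := FractionRing.isScalarTower_liftAlgebra R L
  have hinj : Function.Injective (algebraMap R K) := IsFractionRing.injective R K
  have : CharZero K := charZero_of_injective_algebraMap hinj
  have hy : IsIntegral K (algebraMap O L x) :=
    (hx.algebraMap.extendScalars hinj).isIntegral
  have hirr : Irreducible (minpoly K (algebraMap O L x)) := minpoly.irreducible hy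
  obtain ⟨α, β, hαβ⟩ := hirr.separable
  obtain ⟨s₁, hs₁, Q, hQ⟩ := exists_map_eq_C_mul (R := R) (minpoly K (algebraMap O L x))
  obtain ⟨s₂, hs₂, U, hU⟩ := exists_map_eq_C_mul (R := R) α
  obtain ⟨s₃, hs₃, V, hV⟩ := exists_map_eq_C_mul (R := R) β
  refine ⟨Q, C s₃ * U, C s₂ * V, s₁ * s₂ * s₃, mul_ne_zero (mul_ne_zero hs₁ hs₂) hs₃, ?_, ?_, ?_⟩
  · rintro rfl
    rw [Polynomial.map_zero] at hQ
    exact mul_ne_zero (C_ne_zero.2 ((map_ne_zero_iff _ hinj).2 hs₁)) hirr.ne_zero hQ.symm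
  · apply IsFractionRing.injective O L
    rw [map_zero, ← aeval_algebraMap_apply, ← aeval_map_algebraMap K, hQ, map_mul, minpoly.aeval,
      mul_zero]
  · apply Polynomial.map_injective _ hinj
    simp only [Polynomial.map_add, Polynomial.map_mul, map_C, ← derivative_map, hQ, hU, hV, map_mul,
      derivative_mul, derivative_C, zero_mul, zero_add]
    linear_combination C (algebraMap R K s₁) * C (algebraMap R K s₂) * C (algebraMap R K s₃) * hαβ

theorem exists_forall_separable_map {R O k : Type*} [CommRing R] [IsDomain R] [CharZero R]
    [CommRing O] [IsDomain O] [Algebra R O] [FaithfulSMul R O] [Field k] {x : O}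
    (hx : IsAlgebraic R x) :
    ∃ (Q : R[X]) (r : R), r ≠ 0 ∧ aeval x Q = 0 ∧
      ∀ e : R →+* k, e r ≠ 0 → e Q.leadingCoeff ≠ 0 ∧ (Q.map e).Separable := by
  obtain ⟨Q, U, V, r, hr, hQ, hQx, hUV⟩ := exists_coprime_derivative hx
  refine ⟨Q, Q.leadingCoeff * r, mul_ne_zero (leadingCoeff_ne_zero.2 hQ) hr, hQx, fun e he => ?_⟩
  rw [map_mul, mul_ne_zero_iff] at he
  refine ⟨he.1, C (e r)⁻¹ * U.map e, C (e r)⁻¹ * V.map e, ?_⟩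
  have hUV' : U.map e * Q.map e + V.map e * derivative (Q.map e) = C (e r) := by
    rw [derivative_map, ← Polynomial.map_mul, ← Polynomial.map_mul, ← Polynomial.map_add, hUV,
      map_C]
  rw [mul_assoc, mul_assoc, ← mul_add, hUV', ← C_mul, inv_mul_cancel₀ he.2, C_1]

theorem exists_analyticAt_implicit {𝕜 : Type*} [RCLike 𝕜] {f : 𝕜 × 𝕜 → 𝕜} {z y f' : 𝕜}
    (hf : AnalyticAt 𝕜 f (z, y)) (hf' : HasDerivAt (fun w => f (z, w)) f' y) (h0 : f' ≠ 0) :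
    ∃ η : 𝕜 → 𝕜, AnalyticAt 𝕜 η z ∧ η z = y ∧ ∀ᶠ w in 𝓝 z, f (w, η w) = f (z, y) := by
  have hpartial : HasDerivAt (fun w => f (z, w)) (fderiv 𝕜 f (z, y) (0, 1)) y :=
    hf.differentiableAt.hasFDerivAt.comp_hasDerivAt y
      ((hasDerivAt_const y z).prodMk (hasDerivAt_id y))
  have hinv : (fderiv 𝕜 f (z, y) ∘L .inr 𝕜 𝕜 𝕜).IsInvertible := by
    refine ⟨ContinuousLinearEquiv.unitsEquivAut 𝕜 (Units.mk0 f' h0), ?_⟩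
    ext
    simp [hpartial.unique hf']
  have hcd : ContDiffAt 𝕜 ⊤ f (z, y) := hf.contDiffAt
  exact ⟨hcd.implicitFunction (by simp) hinv,
    (hcd.contDiffAt_implicitFunction (by simp) hinv).analyticAt,
    hcd.implicitFunction_apply_self (by simp) hinv,
    hcd.eventually_apply_implicitFunction (by simp) hinv⟩

variable {q : Sphere → ℂ[X]} {d : ℕ}

theorem exists_regularAt_isRoot {y : ℂ} (hdeg : ∀ x, (q x).natDegree ≤ d)
    (hq : ∀ i, RegularAt (fun x => (q x).coeff i) a) (hy : (q a).IsRoot y)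
    (hy' : (derivative (q a)).eval y ≠ 0) :
    ∃ η : Sphere → ℂ, RegularAt η a ∧ η a = y ∧ ∀ᶠ x in 𝓝 a, (q x).IsRoot (η x) := by
  obtain ⟨c, hc, z, rfl⟩ := exists_isChart a
  have heval : AnalyticAt ℂ (fun p : ℂ × ℂ => (q (c p.1)).eval p.2) (z, y) := by
    simp only [eval_eq_sum_range' (Nat.lt_succ_of_le (hdeg _))]
    exact Finset.analyticAt_fun_sum _ fun i _ =>
      (AnalyticAt.comp_of_eq ((hc.regularAt_iff _ z).1 (hq i)) analyticAt_fst rfl).mul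
        (analyticAt_snd.pow i)
  obtain ⟨η, hη, hηz, hroot⟩ := exists_analyticAt_implicit heval ((q (c z)).hasDerivAt y) hy'
  have hinv : ∀ w, Function.invFun c (c w) = w :=
    Function.leftInverse_invFun hc.isOpenEmbedding.injective
  refine ⟨fun x => η (Function.invFun c x), ?_, by simp only [hinv, hηz], ?_⟩
  · simpa only [hc.regularAt_iff, hinv] using hη
  · rw [hc.eventually_iff]
    filter_upwards [hroot] with w hw
    rw [hinv]
    exact hw.trans hy

theorem exists_mem_eq_of_isRoot {R ι : Type*} [CommRing R] [IsDomain R] {p : R[X]} {S : Finset ι}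
    {f : ι → R} {y : R} (hp : p ≠ 0) (hS : p.natDegree ≤ S.card) (hf : InjOn f S)
    (hroot : ∀ i ∈ S, p.IsRoot (f i)) (hy : p.IsRoot y) : ∃ i ∈ S, f i = y := by
  classical
  have himage : S.image f = p.roots.toFinset := by
    refine Finset.eq_of_subset_of_card_le (Finset.image_subset_iff.2 fun i hi =>
      Multiset.mem_toFinset.2 ((mem_roots hp).2 (hroot i hi))) ?_
    rw [Finset.card_image_of_injOn hf]
    exact (Multiset.toFinset_card_le _).trans ((card_roots' p).trans hS)
  exact Finset.mem_image.1 (himage ▸ Multiset.mem_toFinset.2 ((mem_roots hp).2 hy))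

/-- The `d` germs of roots stay distinct near `a`, and `q x` has at most `d` roots. -/
theorem exists_finset_regularAt_isRoot (hdeg : ∀ x, (q x).natDegree ≤ d)
    (hq : ∀ i, RegularAt (fun x => (q x).coeff i) a) (hd : (q a).coeff d ≠ 0)
    (hsep : (q a).Separable) :
    ∃ S : Finset (Sphere → ℂ), (∀ η ∈ S, RegularAt η a ∧ ∀ᶠ x in 𝓝 a, (q x).IsRoot (η x)) ∧
      ∀ᶠ x in 𝓝 a, ∀ y, (q x).IsRoot y → ∃ η ∈ S, η x = y := by
  classical
  have hroot : ∀ y ∈ (q a).roots.toFinset, ∃ η : Sphere → ℂ, RegularAt η a ∧ η a = y ∧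
      ∀ᶠ x in 𝓝 a, (q x).IsRoot (η x) := fun y hy => by
    have hy' := isRoot_of_mem_roots (Multiset.mem_toFinset.1 hy)
    exact exists_regularAt_isRoot hdeg hq hy' (by
      simpa using hsep.eval₂_derivative_ne_zero (RingHom.id ℂ) (by simpa using hy'))
  choose! η hη hηa hηroot using hroot
  have hcard : (q a).roots.toFinset.card = d := by
    rw [Multiset.toFinset_card_of_nodup (nodup_roots hsep),
      ← (IsAlgClosed.splits (q a)).natDegree_eq_card_roots]
    exact (hdeg a).antisymm (le_natDegree_of_ne_zero hd)
  refine ⟨(q a).roots.toFinset.image η, Finset.forall_mem_image.2 fun y hy =>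
    ⟨hη y hy, hηroot y hy⟩, ?_⟩
  have hne : ∀ᶠ x in 𝓝 a, ∀ y ∈ (q a).roots.toFinset, ∀ y' ∈ (q a).roots.toFinset,
      y ≠ y' → η y x ≠ η y' x := by
    simp only [Finset.eventually_all, eventually_imp_distrib_left]
    intro y hy y' hy' hyy'
    exact ((hη y hy).continuousAt.ne_iff_eventually_ne (hη y' hy').continuousAt).1
      (by rwa [hηa y hy, hηa y' hy'])
  filter_upwards [hne, (Finset.eventually_all _).2 hηroot, (hq d).continuousAt.eventually_ne hd]
    with x hx hxroot hxd y hy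
  have hinj : InjOn (fun y => η y x) (q a).roots.toFinset := fun y hy y' hy' h =>
    by_contra fun hyy' => hx y hy y' hy' hyy' h
  obtain ⟨y₀, hy₀, hy₀y⟩ := exists_mem_eq_of_isRoot (fun h => hxd (by rw [h, coeff_zero]))
    (hcard ▸ hdeg x) hinj hxroot hy
  exact ⟨η y₀, Finset.mem_image_of_mem η hy₀, hy₀y⟩

end SimpleRoots

section Algebraic

open Polynomial

theorem eventuallyEq_of_coeff {q q' : Sphere → ℂ[X]} {d : ℕ} (hq : ∀ x, (q x).natDegree ≤ d)
    (hq' : ∀ x, (q' x).natDegree ≤ d)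
    (h : ∀ i ≤ d, (fun x => (q x).coeff i) =ᶠ[𝓝 a] fun x => (q' x).coeff i) : q =ᶠ[𝓝 a] q' := by
  filter_upwards [(finite_Iic d).eventually_all.2 h] with x hx
  exact (ext_iff_natDegree_le (hq x) (hq' x)).2 hx

theorem RegularAt.exists_eventuallyEq_of_forall_exists {S : Finset (Sphere → ℂ)}
    (hψ : RegularAt ψ a) (hS : ∀ η ∈ S, RegularAt η a)
    (h : ∀ᶠ x in 𝓝 a, ∃ η ∈ S, η x = ψ x) : ∃ η ∈ S, η =ᶠ[𝓝 a] ψ := by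
  by_contra! hne
  have hne' : ∀ᶠ x in 𝓝[≠] a, ∀ η ∈ S, η x ≠ ψ x := (Finset.eventually_all _).2 fun η hη =>
    ((hS η hη).eventuallyEq_or_eventually_ne hψ).resolve_left (hne η hη)
  obtain ⟨x, hx, η, hη, hηx⟩ := (hne'.and (nhdsWithin_le_nhds h)).exists
  exact hx η hη hηx

theorem exists_isContinuationOn_of_isRoot {γ : ℝ → Sphere} {u v : ℝ} {q : ℝ → Sphere → ℂ[X]}
    {d : ℕ} (hγ : Continuous γ) (huv : u ≤ v) (hχ : RegularAt χ (γ u))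
    (hdeg : ∀ t x, (q t x).natDegree ≤ d)
    (hq : ∀ i, IsContinuationOn γ (fun t x => (q t x).coeff i) (Icc u v))
    (hlead : ∀ t ∈ Ioc u v, (q t (γ t)).coeff d ≠ 0)
    (hsep : ∀ t ∈ Ioc u v, (q t (γ t)).Separable) (h : ∀ᶠ x in 𝓝 (γ u), (q u x).IsRoot (χ x)) :
    ∃ F, F u =ᶠ[𝓝 (γ u)] χ ∧ IsContinuationOn γ F (Icc u v) := by
  have q_locally_const : ∀ t ∈ Icc u v, ∀ᶠ s in 𝓝[Ioc u v] t, q s =ᶠ[𝓝 (γ s)] q t := by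
    intro t ht
    filter_upwards [nhdsWithin_mono t Ioc_subset_Icc_self
      ((finite_Iic d).eventually_all.2 fun i _ => (hq i t ht).2)] with s hs
    exact eventuallyEq_of_coeff (hdeg s) (hdeg t) hs
  refine exists_isContinuationOn_of_local hγ huv hχ
    (P := fun s ψ => ∀ᶠ x in 𝓝 (γ s), (q s x).IsRoot (ψ x)) ?_ fun t ht => ?_
  · filter_upwards [q_locally_const u (left_mem_Icc.2 huv), nhdsWithin_le_nhds
      (hγ.continuousAt.eventually (eventually_eventually_nhds.2 h))] with s hqs hs
    filter_upwards [hqs, hs] with x hqx hx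
    rwa [hqx]
  have htI := Ioc_subset_Icc_self ht
  obtain ⟨S, hS, hroots⟩ := exists_finset_regularAt_isRoot (hdeg t) (fun i => (hq i t htI).1)
    (hlead t ht) (hsep t ht)
  have hS' : ∀ᶠ x in 𝓝 (γ t), ∀ η ∈ S, RegularAt η x ∧ ∀ᶠ y in 𝓝 x, (q t y).IsRoot (η y) :=
    (Finset.eventually_all _).2 fun η hη =>
      (hS η hη).1.eventually.and (eventually_eventually_nhds.2 (hS η hη).2)
  refine ⟨_, inter_mem (nhdsWithin_le_nhds (hγ.continuousAt.eventually
    (hS'.and (eventually_eventually_nhds.2 hroots)))) (q_locally_const t htI), ?_⟩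
  rintro s ⟨⟨hSs, hroots_s⟩, hqs⟩ ψ hψ hψroot
  obtain ⟨η, hηS, hηψ⟩ := hψ.exists_eventuallyEq_of_forall_exists (fun η hη => (hSs η hη).1) (by
    filter_upwards [hroots_s, hqs, hψroot] with x hx hqx hψx
    exact hx _ (hqx ▸ hψx))
  refine ⟨η, hηψ, ?_⟩
  rintro r ⟨⟨hSr, -⟩, hqr⟩
  refine ⟨(hSr η hηS).1, ?_⟩
  filter_upwards [hqr, (hSr η hηS).2] with x hqx hx
  rwa [hqx]

/-- The ring of regular germs at `a`. It is the integral domain over which an algebraic equation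
with regular coefficients is read. -/
def regularGerms (a : Sphere) : Subring (Germ (𝓝 a) ℂ) where
  carrier := {g | ∃ φ : Sphere → ℂ, RegularAt φ a ∧ (φ : Germ (𝓝 a) ℂ) = g}
  mul_mem' := by
    rintro _ _ ⟨φ, hφ, rfl⟩ ⟨ψ, hψ, rfl⟩
    exact ⟨_, hφ.mul hψ, rfl⟩
  one_mem' := ⟨_, regularAt_const 1 a, rfl⟩
  add_mem' := by
    rintro _ _ ⟨φ, hφ, rfl⟩ ⟨ψ, hψ, rfl⟩
    exact ⟨_, hφ.add hψ, rfl⟩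
  zero_mem' := ⟨_, regularAt_const 0 a, rfl⟩
  neg_mem' := by
    rintro _ ⟨φ, hφ, rfl⟩
    exact ⟨_, RegularAt.analyticAt_comp analyticAt_id.neg hφ, rfl⟩

/-- The germ of `φ` at `a` as an element of the ring of regular germs. -/
noncomputable def RegularAt.germ (hφ : RegularAt φ a) : regularGerms a := ⟨φ, φ, hφ, rfl⟩

instance (a : Sphere) : CharZero (Germ (𝓝 a) ℂ) := (Germ.valueRingHom (x := a)).charZero

instance (a : Sphere) : IsDomain (regularGerms a) := by
  have : NoZeroDivisors (regularGerms a) := by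
    constructor
    rintro ⟨_, φ, hφ, rfl⟩ ⟨_, ψ, hψ, rfl⟩ h
    have hmul : ∀ᶠ x in 𝓝 a, φ x * ψ x = 0 := Germ.coe_eq.1 (congrArg Subtype.val h)
    have germ_eq_zero : ∀ {χ : Sphere → ℂ} (hχ : RegularAt χ a), (∃ᶠ x in 𝓝[≠] a, χ x = 0) →
        hχ.germ = 0 := fun hχ h =>
      Subtype.ext (Germ.coe_eq.2 (hχ.eventuallyEq_of_frequently (regularAt_const 0 a) h))
    have hfreq : ∃ᶠ x in 𝓝[≠] a, φ x = 0 ∨ ψ x = 0 :=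
      Eventually.frequently (nhdsWithin_le_nhds (hmul.mono fun _ => mul_eq_zero.1))
    exact (frequently_or_distrib.1 hfreq).imp (germ_eq_zero hφ) (germ_eq_zero hψ)
  exact NoZeroDivisors.to_isDomain _

/-- The ring of regular germs at `a` with forbidden set `A`. These germs can be continued
simultaneously along any curve avoiding `A`, compatibly with the ring operations. -/
def forbiddenGerms (A : Set Sphere) (a : Sphere) : Subring (regularGerms a) where
  carrier := {g | ∃ (φ : Sphere → ℂ) (hφ : IsForbidden A a φ), hφ.regularAt.germ = g}
  mul_mem' := by
    rintro _ _ ⟨φ, hφ, rfl⟩ ⟨ψ, hψ, rfl⟩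
    exact ⟨_, hφ.mul hψ, rfl⟩
  one_mem' := ⟨_, isForbidden_const A 1 a, rfl⟩
  add_mem' := by
    rintro _ _ ⟨φ, hφ, rfl⟩ ⟨ψ, hψ, rfl⟩
    exact ⟨_, hφ.add hψ, rfl⟩
  zero_mem' := ⟨_, isForbidden_const A 0 a, rfl⟩
  neg_mem' := by
    rintro _ ⟨φ, hφ, rfl⟩
    exact ⟨_, hφ.entire_comp fun _ => analyticAt_id.neg, rfl⟩

theorem exists_isForbidden_germ_eq (g : forbiddenGerms A a) :
    ∃ φ, IsForbidden A a φ ∧ (φ : Germ (𝓝 a) ℂ) = (g : regularGerms a) := by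
  obtain ⟨φ, hφ, h⟩ := g.2
  exact ⟨φ, hφ, congrArg Subtype.val h⟩

theorem exists_continuation_ringHom {γ : ℝ → Sphere} {u v : ℝ} (hγ : Continuous γ) (huv : u ≤ v)
    (hA : ∀ t ∈ Ioc u v, γ t ∉ A) :
    ∃ F : forbiddenGerms A (γ u) → ℝ → Sphere → ℂ,
      (∀ g, ((F g u : Sphere → ℂ) : Germ (𝓝 (γ u)) ℂ) = (g : regularGerms (γ u))) ∧
      (∀ g, IsContinuationOn γ (F g) (Icc u v)) ∧
      ∀ t ∈ Icc u v, ∃ e : forbiddenGerms A (γ u) →+* ℂ, ∀ g, e g = F g t (γ t) := by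
  have hcont : ∀ g : forbiddenGerms A (γ u), ∃ F : ℝ → Sphere → ℂ,
      ((F u : Sphere → ℂ) : Germ (𝓝 (γ u)) ℂ) = (g : regularGerms (γ u)) ∧
      IsContinuationOn γ F (Icc u v) := fun g => by
    obtain ⟨φ, hφ, hφg⟩ := exists_isForbidden_germ_eq g
    obtain ⟨F, hFφ, hF⟩ := hφ γ hγ u v huv rfl hA
    exact ⟨F, (Germ.coe_eq.2 hFφ).trans hφg, hF⟩
  choose F hFu hF using hcont
  have F_eq : ∀ {g : forbiddenGerms A (γ u)} {G : ℝ → Sphere → ℂ}, IsContinuationOn γ G (Icc u v) →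
      ((G u : Sphere → ℂ) : Germ (𝓝 (γ u)) ℂ) = (g : regularGerms (γ u)) →
      ∀ t ∈ Icc u v, F g t (γ t) = G t (γ t) := fun hG h t ht =>
    ((hF _).eventuallyEq hγ hG isPreconnected_Icc (left_mem_Icc.2 huv) ht
      (Germ.coe_eq.1 ((hFu _).trans h.symm))).eq_of_nhds
  refine ⟨F, hFu, hF, fun t ht => ⟨{
    toFun := fun g => F g t (γ t)
    map_one' := F_eq (isContinuationOn_const fun _ _ => regularAt_const 1 _) rfl t ht
    map_mul' := fun g g' => F_eq ((hF g).analyticAt_comp₂ (e := fun p => p.1 * p.2) (hF g')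
      fun _ _ => analyticAt_fst.mul analyticAt_snd)
      (congrArg₂ (· * ·) (hFu g) (hFu g')) t ht
    map_zero' := F_eq (isContinuationOn_const fun _ _ => regularAt_const 0 _) rfl t ht
    map_add' := fun g g' => F_eq ((hF g).analyticAt_comp₂ (e := fun p => p.1 + p.2) (hF g')
      fun _ _ => analyticAt_fst.add analyticAt_snd)
      (congrArg₂ (· + ·) (hFu g) (hFu g')) t ht }, fun _ => rfl⟩⟩

theorem eventually_eval_eq_zero_of_aeval_eq_zero {Q : (forbiddenGerms A a)[X]}
    {ρ : ℕ → Sphere → ℂ} {d : ℕ} (hd : Q.natDegree ≤ d) (hχ : RegularAt χ a)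
    (hρ : ∀ i, ((ρ i : Sphere → ℂ) : Germ (𝓝 a) ℂ) = (Q.coeff i : regularGerms a))
    (h : aeval hχ.germ Q = 0) :
    ∀ᶠ x in 𝓝 a, ∑ i ∈ Finset.range (d + 1), ρ i x * χ x ^ i = 0 := by
  have hterm : ∀ i, (regularGerms a).subtype (Q.coeff i • hχ.germ ^ i) =
      Germ.coeRingHom (𝓝 a) (fun x => ρ i x * χ x ^ i) := fun i =>
    congrArg (· * (χ : Germ (𝓝 a) ℂ) ^ i) (hρ i).symm
  have hsum := congrArg (regularGerms a).subtype h
  rw [aeval_eq_sum_range' (Nat.lt_succ_of_le hd), map_sum, map_zero,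
    Finset.sum_congr rfl fun i _ => hterm i, ← map_sum] at hsum
  filter_upwards [Germ.coe_eq.1 hsum] with x hx
  simpa using hx

theorem exists_isForbidden_of_isAlgebraic (hA : A.Countable) (hχ : RegularAt χ a)
    (h : IsAlgebraic (forbiddenGerms A a) hχ.germ) :
    ∃ B : Set Sphere, B.Countable ∧ IsForbidden B a χ := by
  obtain ⟨Q, r, hr, hQχ, hQ⟩ := exists_forall_separable_map (k := ℂ) h
  obtain ⟨ρ, -, hρr⟩ := exists_isForbidden_germ_eq r
  have hρ0 : ¬ ρ =ᶠ[𝓝 a] fun _ => 0 := fun h0 =>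
    hr (Subtype.ext (Subtype.ext (hρr.symm.trans (Germ.coe_eq.2 h0))))
  refine ⟨A ∪ {b | ∃ ψ, Reaches a ρ b ψ ∧ ψ b = 0},
    hA.union (Reaches.countable_setOf_apply_eq hρ0), ?_⟩
  rintro γ hγ u v huv rfl hB
  obtain ⟨F, hFu, hF, heval⟩ :=
    exists_continuation_ringHom hγ huv fun t ht h => hB t ht (Or.inl h)
  let d := Q.natDegree
  let q : ℝ → Sphere → ℂ[X] := fun t x =>
    ∑ i ∈ Finset.range (d + 1), C (F (Q.coeff i) t x) * X ^ i
  have q_eq_map : ∀ t ∈ Ioc u v, ∃ e : forbiddenGerms A (γ u) →+* ℂ,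
      q t (γ t) = Q.map e ∧ e r ≠ 0 := by
    intro t ht
    obtain ⟨e, he⟩ := heval t (Ioc_subset_Icc_self ht)
    refine ⟨e, ?_, fun h0 => hB t ht (Or.inr ⟨_, (hF r).reaches_of_mem hγ
      (Germ.coe_eq.1 ((hFu r).trans hρr.symm)) (Ioc_subset_Icc_self ht), he r ▸ h0⟩)⟩
    conv_rhs => rw [Q.as_sum_range_C_mul_X_pow]
    simp only [Polynomial.map_sum, Polynomial.map_mul, Polynomial.map_pow, map_C, map_X, he, q, d]
  refine exists_isContinuationOn_of_isRoot (q := q) (d := d) hγ huv hχ (fun t x => ?_)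
    (fun i => ?_) (fun t ht => ?_) (fun t ht => ?_) ?_
  · exact natDegree_sum_le_of_forall_le _ _ fun i hi =>
      (natDegree_C_mul_X_pow_le _ _).trans (Finset.mem_range_succ_iff.1 hi)
  · simp only [q, finsetSum_coeff, coeff_C_mul_X_pow, Finset.sum_ite_eq]
    split_ifs
    exacts [hF _, isContinuationOn_const fun _ _ => regularAt_const 0 _]
  · obtain ⟨e, hqe, he⟩ := q_eq_map t ht
    rw [hqe, coeff_map]
    exact (hQ e he).1
  · obtain ⟨e, hqe, he⟩ := q_eq_map t ht
    exact hqe ▸ (hQ e he).2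
  · filter_upwards [eventually_eval_eq_zero_of_aeval_eq_zero le_rfl hχ
      (fun i => hFu (Q.coeff i)) hQχ] with x hx
    simpa [q, eval_finsetSum] using hx

theorem exists_isForbidden_of_algebraic {n : ℕ} {φ : Fin n → Sphere → ℂ} (hA : A.Countable)
    (hφ : ∀ i, IsForbidden A a (φ i)) (hχ : RegularAt χ a)
    (h : ∀ᶠ x in 𝓝 a, χ x ^ n + ∑ i : Fin n, φ i x * χ x ^ (n - 1 - (i : ℕ)) = 0) :
    ∃ B : Set Sphere, B.Countable ∧ IsForbidden B a χ := by
  let g : Fin n → forbiddenGerms A a := fun i => ⟨(hφ i).regularAt.germ, φ i, hφ i, rfl⟩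
  have hmonic : (X ^ n + ∑ i : Fin n, C (g i) * X ^ (n - 1 - (i : ℕ))).Monic := by
    refine monic_X_pow_add ((degree_sum_le _ _).trans_lt
      ((Finset.sup_lt_iff (WithBot.bot_lt_coe n)).2 fun i _ => ?_))
    exact (degree_C_mul_X_pow_le _ _).trans_lt (Nat.cast_lt.2 (by omega))
  refine exists_isForbidden_of_isAlgebraic hA hχ ⟨_, hmonic.ne_zero, Subtype.ext ?_⟩
  simp only [map_add, map_sum, map_mul, map_pow, aeval_X, aeval_C]
  rw [Subring.coe_add, AddSubmonoidClass.coe_finsetSum]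
  have hterm : ∀ i : Fin n, ((algebraMap (forbiddenGerms A a) (regularGerms a) (g i) *
      hχ.germ ^ (n - 1 - (i : ℕ)) : regularGerms a) : Germ (𝓝 a) ℂ) =
        Germ.coeRingHom (𝓝 a) (fun x => φ i x * χ x ^ (n - 1 - (i : ℕ))) := fun _ => rfl
  rw [Finset.sum_congr rfl fun i _ => hterm i, ← map_sum]
  refine Germ.coe_eq.2 ?_
  filter_upwards [h] with x hx
  simpa using hx

end Algebraic

section BasicFunctions

/-- Near `a` (at finite points), `φ` is inverse to `u`, that is `u (φ z) = z`; this is the relation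
imposed by `IsInverseFunction` and `IsPower`. -/
def IsInverseNear (u : ℂ → ℂ) (a : Sphere) (φ : Sphere → ℂ) : Prop :=
  ∀ᶠ x in 𝓝 a, ∀ z : ℂ, x = (z : Sphere) → u (φ x) = z

variable {f : ℂ → ℂ} {B : Set ℂ} {γ : ℝ → Sphere} {T : Set ℝ}

theorem exists_coe_eq_of_notMem {x : Sphere}
    (hx : x ∉ (fun z : ℂ => (z : Sphere)) '' B ∪ {OnePoint.infty}) :
    ∃ z ∉ B, (z : Sphere) = x := by
  obtain ⟨z, hz⟩ := OnePoint.ne_infty_iff_exists.1 fun h => hx (Or.inr h)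
  exact ⟨z, fun hzB => hx (Or.inl ⟨z, hzB, hz⟩), hz⟩

theorem isContinuationOn_comp_finiteCoord (hf : ∀ z ∉ B, AnalyticAt ℂ f z)
    (hT : ∀ t ∈ T, γ t ∉ (fun z : ℂ => (z : Sphere)) '' B ∪ {OnePoint.infty}) :
    IsContinuationOn γ (fun _ x => f (finiteCoord x)) T := by
  refine isContinuationOn_const fun t ht => ?_
  obtain ⟨z, hz, hzt⟩ := exists_coe_eq_of_notMem (hT t ht)
  exact hzt ▸ regularAt_coe.2 (hf z hz)

theorem isForbidden_of_function (hf : ∀ z ∉ B, AnalyticAt ℂ f z) (hφ : RegularAt φ a)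
    (h : ∀ᶠ x in 𝓝 a, ∀ z : ℂ, x = (z : Sphere) → φ x = f z) :
    IsForbidden ((fun z : ℂ => (z : Sphere)) '' B ∪ {OnePoint.infty}) a φ := by
  rintro γ hγ u v huv rfl hA
  refine exists_isContinuationOn_of_Ioc huv (isContinuationOn_comp_finiteCoord hf hA) hφ ?_
  filter_upwards [self_mem_nhdsWithin,
    nhdsWithin_le_nhds (hγ.continuousAt.eventually (eventually_eventually_nhds.2 h))] with s hs hsφ
  filter_upwards [hsφ, isOpen_compl_singleton.mem_nhds fun h => hA s hs (Or.inr h)] with x hx hfin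
  obtain ⟨z, rfl⟩ := OnePoint.ne_infty_iff_exists.1 hfin
  exact (hx z rfl).symm

theorem isForbidden_of_hasDerivAt (hB : IsClosed B) (hf : ∀ z ∉ B, AnalyticAt ℂ f z)
    (hφ : RegularAt φ a)
    (h : ∀ᶠ x in 𝓝 a, ∀ z ∉ B, x = (z : Sphere) → HasDerivAt (fun w : ℂ => φ w) (f z) z) :
    IsForbidden ((fun z : ℂ => (z : Sphere)) '' B ∪ {OnePoint.infty}) a φ := by
  rintro γ hγ u v huv rfl hA
  refine exists_isContinuationOn_of_isDerivativeNear hγ huv hφ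
    (isContinuationOn_comp_finiteCoord hf hA) (fun t ht h => hA t ht (Or.inr h)) ?_
  filter_upwards [self_mem_nhdsWithin,
    nhdsWithin_le_nhds (hγ.continuousAt.eventually (eventually_eventually_nhds.2 h))] with s hs hsφ
  obtain ⟨z, hz, hzs⟩ := exists_coe_eq_of_notMem (hA s hs)
  have hB' : ∀ᶠ x in 𝓝 (γ s), finiteCoord x ∉ B :=
    hzs ▸ isChart_coe.eventually_iff.2 (hB.isOpen_compl.mem_nhds hz)
  filter_upwards [hsφ, hB'] with x hx hxB
  rintro w rfl
  exact hx w hxB rfl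

end BasicFunctions

namespace IsInverseNear

variable {f f' g : ℂ → ℂ}

theorem eventually_mul_finiteDeriv (h : IsInverseNear f a φ) (hφ : RegularAt φ a) :
    ∀ᶠ x in 𝓝 a, ∀ z d : ℂ, x = (z : Sphere) → HasDerivAt f d (φ x) →
      d * finiteDeriv φ x = 1 := by
  filter_upwards [eventually_eventually_nhds.2 h, hφ.eventually]
  rintro _ hx hxφ z d rfl hd
  have hcomp : HasDerivAt (fun w : ℂ => f (φ w)) (d * finiteDeriv φ z) z :=
    hd.comp z (regularAt_coe.1 hxφ).differentiableAt.hasDerivAt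
  refine hcomp.unique ((hasDerivAt_id z).congr_of_eventuallyEq ?_)
  filter_upwards [isChart_coe.eventually_iff.1 hx] with w hw using hw w rfl

theorem isForbidden {B : Set ℂ} (h : IsInverseNear f a φ) (hφ : RegularAt φ a) (hB : IsClosed B)
    (hg : ∀ z ∉ B, AnalyticAt ℂ g z) (hf : ∀ y, f y ∉ B → HasDerivAt f (g (f y))⁻¹ y) :
    IsForbidden ((fun z : ℂ => (z : Sphere)) '' B ∪ {OnePoint.infty}) a φ := by
  refine isForbidden_of_hasDerivAt hB hg hφ ?_
  filter_upwards [h, h.eventually_mul_finiteDeriv hφ, hφ.eventually]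
  rintro _ hx hxd hxφ z hz rfl
  have hderiv : HasDerivAt f (g z)⁻¹ (φ z) := by
    simpa only [hx z rfl] using hf (φ z) (by rwa [hx z rfl])
  have hmul : (g z)⁻¹ * finiteDeriv φ z = 1 := hxd z _ rfl hderiv
  rw [← inv_inv (g z), ← eq_inv_of_mul_eq_one_right hmul]
  exact (regularAt_coe.1 hxφ).differentiableAt.hasDerivAt

/-- In the coordinate `w = 1 / x` the relation reads `w * f (φ x) = 1`, which fails at `w = 0`. -/
theorem ne_infty (h : IsInverseNear f a φ) (hφ : RegularAt φ a) (hf : Continuous f) :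
    a ≠ OnePoint.infty := by
  rintro rfl
  rw [IsInverseNear, ← chartInfty_zero] at h
  rw [← chartInfty_zero] at hφ
  have hcont : ContinuousAt (fun w : ℂ => w * f (φ (chartInfty w))) 0 :=
    continuousAt_id.mul (hf.continuousAt.comp
      (hφ.continuousAt.comp continuous_chartInfty.continuousAt))
  have hzero : Tendsto (fun w : ℂ => w * f (φ (chartInfty w))) (𝓝[≠] 0) (𝓝 0) :=
    tendsto_nhdsWithin_of_tendsto_nhds (by simpa using hcont.tendsto)
  have hone : Tendsto (fun w : ℂ => w * f (φ (chartInfty w))) (𝓝[≠] 0) (𝓝 1) := by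
    refine tendsto_const_nhds.congr' ?_
    filter_upwards [nhdsWithin_le_nhds (isChart_chartInfty.eventually_iff.1 h),
      self_mem_nhdsWithin] with w hw hw0
    rw [hw w⁻¹ (chartInfty_of_ne_zero hw0), mul_inv_cancel₀ hw0]
  exact zero_ne_one (tendsto_nhds_unique hzero hone)

theorem exists_isForbidden_of_comp_deriv (h : IsInverseNear f a φ) (hφ : RegularAt φ a)
    (hf : ∀ y, HasDerivAt f (f' y) y) (hA : A.Countable)
    (hf' : IsForbidden A a fun x => f' (φ x)) :
    ∃ B : Set Sphere, B.Countable ∧ IsForbidden B a φ := by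
  have ha : a ≠ OnePoint.infty :=
    h.ne_infty hφ (continuous_iff_continuousAt.2 fun y => (hf y).continuousAt)
  have hmul : ∀ᶠ x in 𝓝 a, finiteDeriv φ x * f' (φ x) = 1 := by
    filter_upwards [h.eventually_mul_finiteDeriv hφ, isOpen_compl_singleton.mem_nhds ha]
      with x hx hfin
    obtain ⟨z, hz⟩ := OnePoint.ne_infty_iff_exists.1 hfin
    exact mul_comm (f' (φ x)) _ ▸ hx z _ hz.symm (hf _)
  have hne : ¬ (fun x => f' (φ x)) =ᶠ[𝓝 a] fun _ => 0 := fun h0 =>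
    right_ne_zero_of_mul_eq_one hmul.self_of_nhds h0.self_of_nhds
  exact ⟨_, (hA.union (Reaches.countable_setOf_apply_eq hne)).union (countable_singleton _),
    ((isForbidden_const A 1 a).div hf' (hφ.finiteDeriv ha) hmul).integral hφ
      (hφ.isDerivativeNear_finiteDeriv ha)⟩

theorem exists_isForbidden_comp (h : IsInverseNear f a φ) (hφ : RegularAt φ a)
    (ha : a ≠ OnePoint.infty) (hg : Differentiable ℂ g) (hsq : ∀ y, g y ^ 2 + f y ^ 2 = 1) :
    ∃ A : Set Sphere, A.Countable ∧ IsForbidden A a fun x => g (φ x) := by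
  let p : ℂ → ℂ := fun z => z ^ 2 - 1
  have hp : Differentiable ℂ p := by fun_prop
  have hpa : RegularAt (fun x => p (finiteCoord x)) a := by
    obtain ⟨z, rfl⟩ := OnePoint.ne_infty_iff_exists.1 ha
    exact regularAt_coe.2 (hp.analyticAt z)
  let coeff : Fin 2 → Sphere → ℂ := ![fun _ => 0, fun x => p (finiteCoord x)]
  refine exists_isForbidden_of_algebraic (φ := coeff)
    ((countable_empty.image fun z : ℂ => (z : Sphere)).union (countable_singleton OnePoint.infty))
    (Fin.forall_fin_two.2 ⟨isForbidden_const _ 0 a, ?_⟩)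
    (RegularAt.analyticAt_comp (hg.analyticAt _) hφ) ?_
  · refine isForbidden_of_function (fun z _ => hp.analyticAt z) hpa (Eventually.of_forall ?_)
    rintro _ z rfl
    rfl
  · filter_upwards [h, isOpen_compl_singleton.mem_nhds ha] with x hx hfin
    obtain ⟨z, rfl⟩ := OnePoint.ne_infty_iff_exists.1 hfin
    simpa [coeff, p, finiteCoord_coe, hx z rfl, add_sub_assoc] using sub_eq_zero.2 (hsq (φ z))

theorem exists_isForbidden_of_sq_add_sq (h : IsInverseNear f a φ) (hφ : RegularAt φ a)
    (hf : ∀ y, HasDerivAt f (f' y) y) (hf' : Differentiable ℂ f')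
    (hsq : ∀ y, f' y ^ 2 + f y ^ 2 = 1) :
    ∃ A : Set Sphere, A.Countable ∧ IsForbidden A a φ := by
  have hcont : Continuous f := continuous_iff_continuousAt.2 fun y => (hf y).continuousAt
  obtain ⟨A, hA, hforb⟩ := h.exists_isForbidden_comp hφ (h.ne_infty hφ hcont) hf' hsq
  exact h.exists_isForbidden_of_comp_deriv hφ hf hA hforb

theorem exists_isForbidden_exp (h : IsInverseNear Complex.exp a φ) (hφ : RegularAt φ a) :
    ∃ A : Set Sphere, A.Countable ∧ IsForbidden A a φ := by
  refine ⟨_, ((countable_singleton 0).image _).union (countable_singleton _),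
    h.isForbidden (g := fun z => z⁻¹) hφ isClosed_singleton (fun z hz => analyticAt_inv hz)
      fun y _ => ?_⟩
  rw [inv_inv]
  exact Complex.hasDerivAt_exp y

end IsInverseNear

section Arctangent

theorem one_add_sq_ne_zero {z : ℂ} (hI : z ≠ Complex.I) (hI' : z ≠ -Complex.I) : 1 + z ^ 2 ≠ 0 := by
  have hmul : 1 + z ^ 2 = (z - Complex.I) * (z + Complex.I) := by
    linear_combination Complex.I_sq
  rw [hmul, ← sub_neg_eq_add z]
  exact mul_ne_zero (sub_ne_zero.2 hI) (sub_ne_zero.2 hI')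

theorem cos_ne_zero_of_tan_ne_zero {y : ℂ} (hy : Complex.tan y ≠ 0) : Complex.cos y ≠ 0 :=
  fun h => hy (by rw [Complex.tan_eq_sin_div_cos, h, div_zero])

theorem sin_ne_zero_of_cot_ne_zero {y : ℂ} (hy : Complex.cot y ≠ 0) : Complex.sin y ≠ 0 :=
  fun h => hy (by rw [Complex.cot_eq_cos_div_sin, h, div_zero])

theorem hasDerivAt_tan_one_add_sq {y : ℂ} (hy : Complex.cos y ≠ 0) :
    HasDerivAt Complex.tan (1 + Complex.tan y ^ 2) y := by
  refine (Complex.hasDerivAt_tan hy).congr_deriv ?_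
  rw [Complex.tan_eq_sin_div_cos]
  field_simp
  exact (Complex.cos_sq_add_sin_sq y).symm

theorem hasDerivAt_cot_neg_one_add_sq {y : ℂ} (hy : Complex.sin y ≠ 0) :
    HasDerivAt Complex.cot (-(1 + Complex.cot y ^ 2)) y := by
  refine ((Complex.hasDerivAt_cos y).div (Complex.hasDerivAt_sin y) hy).congr_deriv ?_
  rw [Complex.cot_eq_cos_div_sin]
  field_simp
  ring

namespace IsInverseNear

variable {f g : ℂ → ℂ}

/-- The value `0` is excluded because `Complex.tan` and `Complex.cot` take it as a junk value at
their poles. -/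
theorem exists_isForbidden_of_one_add_sq {κ : ℂ} (h : IsInverseNear f a φ) (hφ : RegularAt φ a)
    (hf : ∀ y, f y ≠ 0 → HasDerivAt f (κ * (1 + f y ^ 2)) y) :
    ∃ A : Set Sphere, A.Countable ∧ IsForbidden A a φ := by
  have hfin : ({0, Complex.I, -Complex.I} : Set ℂ).Finite := toFinite _
  refine ⟨_, (hfin.countable.image _).union (countable_singleton _),
    h.isForbidden (g := fun z => κ⁻¹ * (1 + z ^ 2)⁻¹) hφ hfin.isClosed (fun z hz => ?_)
      fun y hy => ?_⟩
  · simp only [mem_insert_iff, mem_singleton_iff, not_or] at hz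
    exact analyticAt_const.mul
      ((analyticAt_const.add (analyticAt_id.pow 2)).inv (one_add_sq_ne_zero hz.2.1 hz.2.2))
  · rw [mul_inv, inv_inv, inv_inv]
    exact hf y fun h0 => hy (Or.inl h0)

theorem exists_isForbidden_tan (h : IsInverseNear Complex.tan a φ) (hφ : RegularAt φ a) :
    ∃ A : Set Sphere, A.Countable ∧ IsForbidden A a φ :=
  h.exists_isForbidden_of_one_add_sq (κ := 1) hφ fun _ hy =>
    (one_mul (1 + Complex.tan _ ^ 2)).symm ▸
      hasDerivAt_tan_one_add_sq (cos_ne_zero_of_tan_ne_zero hy)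

theorem exists_isForbidden_cot (h : IsInverseNear Complex.cot a φ) (hφ : RegularAt φ a) :
    ∃ A : Set Sphere, A.Countable ∧ IsForbidden A a φ :=
  h.exists_isForbidden_of_one_add_sq (κ := -1) hφ fun _ hy =>
    (neg_one_mul (1 + Complex.cot _ ^ 2)).symm ▸
      hasDerivAt_cot_neg_one_add_sq (sin_ne_zero_of_cot_ne_zero hy)

end IsInverseNear

end Arctangent

/-- Some countable set is forbidden for all germs of `f`. This is the property of multivalued
functions that all basic functions have and all operations preserve. -/
def HasCountableForbiddenSet (f : MultivaluedFunction) : Prop :=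
  ∃ A : Set Sphere, A.Countable ∧ ∀ b ψ, f.IsGerm b ψ → IsForbidden A b ψ

section ForbiddenSets

variable {f : MultivaluedFunction}

theorem HasCountableForbiddenSet.countable_singularPoints (hf : HasCountableForbiddenSet f) :
    f.singularPoints.Countable := by
  obtain ⟨A, hA, h⟩ := hf
  refine hA.mono ?_
  rintro b ⟨a, φ, hφ, hs⟩
  exact (h a φ hφ).mem_of_isSingularPoint hA hs

theorem MultivaluedFunction.IsGeneratedBy.hasCountableForbiddenSet (hf : f.IsGeneratedBy a φ)
    (h : ∃ A : Set Sphere, A.Countable ∧ IsForbidden A a φ) : HasCountableForbiddenSet f := by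
  obtain ⟨A, hA, hφ⟩ := h
  exact ⟨A, hA, fun b ψ hb => hφ.of_reaches hA ((hf.2 b ψ).1 hb).reaches⟩

namespace IsFunction

variable {u : ℂ → ℂ}

theorem hasCountableForbiddenSet {B : Set ℂ} (hf : IsFunction u f) (hB : B.Countable)
    (hu : ∀ z ∉ B, AnalyticAt ℂ u z) : HasCountableForbiddenSet f := by
  obtain ⟨a, φ, hgen, h⟩ := hf
  exact hgen.hasCountableForbiddenSet ⟨_, (hB.image _).union (countable_singleton _),
    isForbidden_of_function hu hgen.1 h⟩

theorem hasCountableForbiddenSet_of_differentiable (hf : IsFunction u f)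
    (hu : Differentiable ℂ u) : HasCountableForbiddenSet f :=
  hf.hasCountableForbiddenSet countable_empty fun z _ => hu.analyticAt z

end IsFunction

theorem IsInverseFunction.hasCountableForbiddenSet {u : ℂ → ℂ} (hf : IsInverseFunction u f)
    (h : ∀ {a φ}, IsInverseNear u a φ → RegularAt φ a →
      ∃ A : Set Sphere, A.Countable ∧ IsForbidden A a φ) : HasCountableForbiddenSet f := by
  obtain ⟨a, φ, hgen, hu⟩ := hf
  exact hgen.hasCountableForbiddenSet (h hu hgen.1)

theorem IsPower.hasCountableForbiddenSet {α : ℂ} (hf : IsPower α f) :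
    HasCountableForbiddenSet f := by
  obtain ⟨a, l, hl, hexp, hgen⟩ := hf
  obtain ⟨A, hA, hlA⟩ := IsInverseNear.exists_isForbidden_exp hexp hl
  have hα : Differentiable ℂ fun z => Complex.exp (α * z) := by fun_prop
  exact hgen.hasCountableForbiddenSet
    ⟨A, hA, hlA.entire_comp (e := fun z => Complex.exp (α * z)) hα.analyticAt⟩

theorem countable_setOf_cos_eq_zero : {z : ℂ | Complex.cos z = 0}.Countable := by
  refine (countable_range fun k : ℤ => (2 * k + 1) * (Real.pi : ℂ) / 2).mono fun z hz => ?_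
  obtain ⟨k, hk⟩ := Complex.cos_eq_zero_iff.1 hz
  exact ⟨k, hk.symm⟩

theorem countable_setOf_sin_eq_zero : {z : ℂ | Complex.sin z = 0}.Countable := by
  refine (countable_range fun k : ℤ => (k : ℂ) * Real.pi).mono fun z hz => ?_
  obtain ⟨k, hk⟩ := Complex.sin_eq_zero_iff.1 hz
  exact ⟨k, hk.symm⟩

theorem BasicElementary.hasCountableForbiddenSet (hf : BasicElementary f) :
    HasCountableForbiddenSet f := by
  cases hf with
  | const c h => exact h.hasCountableForbiddenSet_of_differentiable (differentiable_const c)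
  | var h => exact h.hasCountableForbiddenSet_of_differentiable differentiable_id
  | exp h => exact h.hasCountableForbiddenSet_of_differentiable Complex.differentiable_exp
  | sin h => exact h.hasCountableForbiddenSet_of_differentiable Complex.differentiable_sin
  | cos h => exact h.hasCountableForbiddenSet_of_differentiable Complex.differentiable_cos
  | tan h =>
    exact h.hasCountableForbiddenSet countable_setOf_cos_eq_zero fun z hz =>
      (Complex.differentiable_sin.analyticAt z).fun_div (Complex.differentiable_cos.analyticAt z) hz
  | cot h =>
    exact h.hasCountableForbiddenSet countable_setOf_sin_eq_zero fun z hz =>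
      (Complex.differentiable_cos.analyticAt z).fun_div (Complex.differentiable_sin.analyticAt z) hz
  | log h => exact h.hasCountableForbiddenSet IsInverseNear.exists_isForbidden_exp
  | power _ h => exact h.hasCountableForbiddenSet
  | arctan h => exact h.hasCountableForbiddenSet IsInverseNear.exists_isForbidden_tan
  | arccot h => exact h.hasCountableForbiddenSet IsInverseNear.exists_isForbidden_cot
  | arcsin h =>
    exact h.hasCountableForbiddenSet fun hu hφ => hu.exists_isForbidden_of_sq_add_sq hφ
      Complex.hasDerivAt_sin Complex.differentiable_cos Complex.cos_sq_add_sin_sq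
  | arccos h =>
    exact h.hasCountableForbiddenSet fun hu hφ => hu.exists_isForbidden_of_sq_add_sq hφ
      Complex.hasDerivAt_cos Complex.differentiable_sin.neg fun y => by simp

end ForbiddenSets

section Operations

variable {fs : List MultivaluedFunction} {f g h : MultivaluedFunction}

theorem Composition.hasCountableForbiddenSet (hop : Composition fs h)
    (hfs : ∀ f ∈ fs, HasCountableForbiddenSet f) : HasCountableForbiddenSet h := by
  cases hop with
  | @comp f g _ a φ ψ hg hf hgen =>
    obtain ⟨B, hB, hfB⟩ := hfs f (by simp)
    obtain ⟨A, hA, hgA⟩ := hfs g (by simp)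
    refine hgen.hasCountableForbiddenSet ?_
    by_cases hconst : ψ =ᶠ[𝓝 a] fun _ => ψ a
    · refine ⟨∅, countable_empty, (isForbidden_const ∅ (φ ((ψ a : ℂ) : Sphere)) a).congr ?_⟩
      filter_upwards [hconst] with x hx
      rw [hx]
    · refine ⟨_, hA.union ?_, (hfB _ _ hf).comp (hgA _ _ hg)⟩
      have hk : ∀ k : ℂ, {b | ∃ ψ', Reaches a ψ b ψ' ∧ ψ' b = k}.Countable := fun k =>
        Reaches.countable_setOf_apply_eq fun hk => hconst (hk.trans (by rw [hk.eq_of_nhds]))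
      refine ((hB.preimage OnePoint.coe_injective).biUnion fun k _ => hk k).mono ?_
      rintro b ⟨ψ', hψ', hb⟩
      exact mem_iUnion₂.2 ⟨ψ' b, hb, ψ', hψ', rfl⟩

theorem HasCountableForbiddenSet.exists_isForbidden₂ (hf : HasCountableForbiddenSet f)
    (hg : HasCountableForbiddenSet g) (hφ : f.IsGerm a φ) (hψ : g.IsGerm a ψ) :
    ∃ A : Set Sphere, A.Countable ∧ IsForbidden A a φ ∧ IsForbidden A a ψ := by
  obtain ⟨A, hA, hfA⟩ := hf
  obtain ⟨B, hB, hgB⟩ := hg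
  exact ⟨A ∪ B, hA.union hB, (hfA a φ hφ).mono subset_union_left,
    (hgB a ψ hψ).mono subset_union_right⟩

theorem Arithmetic.hasCountableForbiddenSet (hop : Arithmetic fs h)
    (hfs : ∀ f ∈ fs, HasCountableForbiddenSet f) : HasCountableForbiddenSet h := by
  cases hop with
  | @add f g _ _ _ _ hf hg hgen =>
    obtain ⟨A, hA, hφ, hψ⟩ := (hfs f (by simp)).exists_isForbidden₂ (hfs g (by simp)) hf hg
    exact hgen.hasCountableForbiddenSet ⟨A, hA, hφ.add hψ⟩
  | @sub f g _ _ _ _ hf hg hgen =>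
    obtain ⟨A, hA, hφ, hψ⟩ := (hfs f (by simp)).exists_isForbidden₂ (hfs g (by simp)) hf hg
    exact hgen.hasCountableForbiddenSet ⟨A, hA, hφ.sub hψ⟩
  | @mul f g _ _ _ _ hf hg hgen =>
    obtain ⟨A, hA, hφ, hψ⟩ := (hfs f (by simp)).exists_isForbidden₂ (hfs g (by simp)) hf hg
    exact hgen.hasCountableForbiddenSet ⟨A, hA, hφ.mul hψ⟩
  | @div f g _ _ _ _ _ hf hg h0 hgen heq =>
    obtain ⟨A, hA, hφ, hψ⟩ := (hfs f (by simp)).exists_isForbidden₂ (hfs g (by simp)) hf hg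
    exact hgen.hasCountableForbiddenSet
      ⟨_, hA.union (Reaches.countable_setOf_apply_eq h0), hφ.div hψ hgen.1 heq⟩

theorem Differentiation.hasCountableForbiddenSet (hop : Differentiation fs h)
    (hfs : ∀ f ∈ fs, HasCountableForbiddenSet f) : HasCountableForbiddenSet h := by
  cases hop with
  | @deriv f _ _ _ _ hf hgen hd =>
    obtain ⟨A, hA, hfA⟩ := hfs f (by simp)
    exact hgen.hasCountableForbiddenSet
      ⟨_, hA.union (countable_singleton _), (hfA _ _ hf).deriv hgen.1 hd⟩

theorem Integration.hasCountableForbiddenSet (hop : Integration fs h)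
    (hfs : ∀ f ∈ fs, HasCountableForbiddenSet f) : HasCountableForbiddenSet h := by
  cases hop with
  | @integral f _ _ _ _ hf hgen hd =>
    obtain ⟨A, hA, hfA⟩ := hfs f (by simp)
    exact hgen.hasCountableForbiddenSet
      ⟨_, hA.union (countable_singleton _), (hfA _ _ hf).integral hgen.1 hd⟩

namespace Algebraic

variable {D D' : ℕ → Prop}

theorem hasCountableForbiddenSet (hop : Algebraic D fs h)
    (hfs : ∀ f ∈ fs, HasCountableForbiddenSet f) : HasCountableForbiddenSet h := by
  cases hop with
  | @solution n f _ _ _ _ _ hf hgen heq =>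
    choose A hA hfA using fun i => hfs (f i) (by simp)
    exact hgen.hasCountableForbiddenSet (exists_isForbidden_of_algebraic (countable_iUnion hA)
      (fun i => (hfA i _ _ (hf i)).mono (subset_iUnion A i)) hgen.1 heq)

theorem mono (hD : ∀ n, D n → D' n) : Algebraic D ≤ Algebraic D' := by
  rintro fs g ⟨hn, hf, hgen, heq⟩
  exact .solution (hD _ hn) hf hgen heq

end Algebraic

namespace FunctionClass

variable {Basic : MultivaluedFunction → Prop} {Op Op' : Operation}

theorem hasCountableForbiddenSet (hf : FunctionClass Basic Op f)
    (hBasic : ∀ f, Basic f → HasCountableForbiddenSet f)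
    (hOp : ∀ fs h, Op fs h → (∀ f ∈ fs, HasCountableForbiddenSet f) →
      HasCountableForbiddenSet h) : HasCountableForbiddenSet f := by
  induction hf with
  | basic hb => exact hBasic _ hb
  | op _ hop ih => exact hOp _ _ hop ih

theorem mono (hf : FunctionClass Basic Op f) (hOp : Op ≤ Op') : FunctionClass Basic Op' f := by
  induction hf with
  | basic hb => exact .basic hb
  | op _ hop ih => exact .op ih (hOp _ _ hop)

end FunctionClass

theorem RepresentableByGeneralizedQuadratures.hasCountableForbiddenSet
    (hf : RepresentableByGeneralizedQuadratures f) : HasCountableForbiddenSet f := by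
  refine FunctionClass.hasCountableForbiddenSet hf
    (fun _ hb => hb.hasCountableForbiddenSet) fun fs h hop hfs => ?_
  obtain (((hop | hop) | hop) | hop) | hop := hop <;> exact hop.hasCountableForbiddenSet hfs

end Operations

end FiniteTerms

theorem corollary5 (f : FiniteTerms.MultivaluedFunction) (hf : ¬ f.singularPoints.Countable) :
    ¬ FiniteTerms.RepresentableByGeneralizedQuadratures f ∧
    ¬ FiniteTerms.GeneralizedElementary f ∧
    (∀ k : ℕ, ¬ FiniteTerms.RepresentableByKQuadratures k f) ∧
    ¬ FiniteTerms.RepresentableByQuadratures f := by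
  have key : ¬ FiniteTerms.RepresentableByGeneralizedQuadratures f := fun h =>
    hf h.hasCountableForbiddenSet.countable_singularPoints
  refine ⟨key, fun h => key (h.mono ?_), fun k h => key (h.mono ?_), fun h => key (h.mono ?_)⟩
  · exact sup_le_sup_right le_sup_left _
  · exact sup_le_sup_left (FiniteTerms.Algebraic.mono fun _ _ => trivial) _
  · exact le_sup_left
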